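/- **Setting.** All Hilbert spaces are complex, inner products are linear in the first argument, and $\mathcal H^*$ denotes the anti-dual (bounded conjugate-linear functionals) of a Hilbert space $\mathcal H$, with linear Riesz isomorphism $\mathcal R_{\mathcal H}:\mathcal H\to\mathcal H^*$. Let $\mathcal X,\mathcal Y$ be Hilbert spaces. Let $A:\mathcal X\supset\operatorname{dom}A\to\mathcal Y$ be closed and densely defined such that $S=A^*A$ is uniformly positive, i.e. there is $c>0$ with $\langle x,Sx\rangle\ge c\|x\|^2$ for all $x\in\operatorname{dom}S$. Let $B:\mathcal Y\supset\operatorname{dom}B\to\mathcal X$ be closed and densely defined with $A^*\subset -B$. Let $\mathcal X_h=\operatorname{dom}A$ with inner product $\langle Ax,Ay\rangle_{\mathcal Y}$ (a Hilbert space), let $\mathcal Z_h=\mathcal X_h\times\mathcal X$, and define on $\mathcal Z_h$ $$\operatorname{dom}\mathcal A=\{(z_1,z_2)\in\mathcal X_h\times\mathcal X_h : Az_1\in\operatorname{dom}B\},\qquad \mathcal A(z_1,z_2)=(z_2,\,BAz_1),\qquad \mathcal A_0:=\mathcal A^*.$$ Let $\mathcal G_1,\mathcal G_2$ be Hilbert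 spaces and let $\Lambda=(\Lambda_1,\Lambda_2):\operatorname{dom}A\to\mathcal G_1\times\mathcal G_2^*$ and $\Pi=(\Pi_1,\Pi_2):\operatorname{dom}B\to\mathcal G_1^*\times\mathcal G_2$ be linear and surjective with $$-\langle By,x\rangle_{\mathcal X}-\langle y,Ax\rangle_{\mathcal Y}=\langle\Pi_1y,\Lambda_1x\rangle_{\mathcal G_1^*,\mathcal G_1}-\langle\Pi_2y,\Lambda_2x\rangle_{\mathcal G_2,\mathcal G_2^*}\qquad(x\in\operatorname{dom}A,\ y\in\operatorname{dom}B).$$ Put $\mathcal G=\mathcal G_1\times\mathcal G_2$, identify $\mathcal G^*=\mathcal G_1^*\times\mathcal G_2^*$, and for $z=(z_1,z_2)\in\operatorname{dom}\mathcal A$ let $\Gamma_0z=(\Lambda_1z_2,\Pi_2Az_1)\in\mathcal G$ and $\Gamma_1z=(-\Pi_1Az_1,\Lambda_2z_2)\in\mathcal G^*$. **Definitions.** A colligation consists of linear maps $G,L,K$ on a common domain $\mathcal Z$ in the state space, with values in the input space, the state space and the output space. It is a *boundary node* if the combined operator $(G,L,K)$ is closed, $G$ is surjective, $\ker G$ is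 dense in the state space, and $L|_{\ker G}$ has non-empty resolvent set; it is *internally well-posed* if moreover $L|_{\ker G}$ generates a strongly continuous semigroup. A *smooth solution* consists of $u\in C^2$, of $z$ that is $C^1$ in the state space and continuous in $\mathcal Z$ with the graph norm of $(G,L,K)$, and of $y$, with $u=Gz$, $\dot z=Lz$, $y=Kz$ on $[0,\infty)$. An internally well-posed boundary node is *scattering passive* if all smooth solutions satisfy $\frac{d}{dt}\|z(t)\|^2+\|y(t)\|^2\le\|u(t)\|^2$ for all $t\ge0$, and *scattering energy-preserving* if they satisfy this with equality. **Theorem.** We have $\mathcal A_0^*=\mathcal A$. Let $P\in L(\mathcal G^*)$ and let $N$ be the colligation with domain $\operatorname{dom}\mathcal A_0^*$, input and output space $\mathcal G^*$, state space $\mathcal Z_h$, input operator $\tfrac1{\sqrt2}(\mathcal R_{\mathcal G}\Gamma_0+\Gamma_1)$, interior operator $\mathcal A_0^*$ and output operator $-\tfrac1{\sqrt2}P(\mathcal R_{\mathcal G}\Gamma_0-\Gamma_1)$. Then 1. $N$ is a scattering passive boundary node if and only if $\|P\|\le1$. 2. $N$ is a scattering energy-preserving boundary node if and only if $P$ is norm-preserving,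 i.e. $\|Pg\|=\|g\|$ for all $g\in\mathcal G^*$. 3. $P$ is unitary if and only if $N$ is a scattering energy-preserving boundary node and $P$ is surjective. In particular, if $\mathcal G$ is finite-dimensional, then $N$ is a scattering energy-preserving boundary node if and only if $P$ is unitary. -/

import Mathlib

open Set Filter Topology
open scoped ComplexConjugate InnerProductSpace

noncomputable section

/-! ### Anti-duals of Hilbert spaces

All Hilbert spaces are complex.  Mathlib's `inner ℂ x y` is conjugate linear in `x`; an inner
product `⟨x, y⟩` that is linear in its first argument is therefore `inner ℂ y x`. -/

/-- The anti-dual: bounded conjugate linear functionals, with the operator norm.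
The pairing `⟨f, x⟩` of `f` in the anti-dual with `x` is `f x`, and `⟨x, f⟩ = conj (f x)`. -/
abbrev AntiDual (E : Type*) [NormedAddCommGroup E] [InnerProductSpace ℂ E] : Type _ :=
  E →L⋆[ℂ] ℂ

/-- The linear Riesz isomorphism of a Hilbert space onto its anti-dual,
`x ↦ (y ↦ inner ℂ y x)`. -/
def rieszIso (E : Type*) [NormedAddCommGroup E] [InnerProductSpace ℂ E] [CompleteSpace E] :
    E ≃ₗᵢ[ℂ] AntiDual E :=
  LinearIsometryEquiv.ofSurjective
    { toLinearMap := (innerSLFlip ℂ (E := E)).toLinearMap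
      norm_map' := fun x => by
        apply le_antisymm
        · refine ContinuousLinearMap.opNorm_le_bound _ (norm_nonneg x) fun y => ?_
          simpa [mul_comm] using norm_inner_le_norm (𝕜 := ℂ) y x
        · rcases eq_or_ne x 0 with rfl | hx
          · simp
          · have h := ContinuousLinearMap.le_opNorm (innerSLFlip ℂ x) x
            have h2 : ‖(innerSLFlip ℂ x) x‖ = ‖x‖ * ‖x‖ := by
              simp [inner_self_eq_norm_sq_to_K, sq]
            rw [h2] at h
            exact le_of_mul_le_mul_right h (norm_pos_iff.2 hx) }
    (fun f => by
      let g : StrongDual ℂ E := (starL ℂ (A := ℂ) : ℂ →L⋆[ℂ] ℂ).comp f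
      refine ⟨(InnerProductSpace.toDual ℂ E).symm g, ?_⟩
      ext y
      have h : inner ℂ ((InnerProductSpace.toDual ℂ E).symm g) y = g y :=
        InnerProductSpace.toDual_symm_apply
      change inner ℂ y ((InnerProductSpace.toDual ℂ E).symm g) = f y
      rw [← inner_conj_symm, h]
      simp [g])

theorem rieszIso_apply {E : Type*} [NormedAddCommGroup E] [InnerProductSpace ℂ E]
    [CompleteSpace E] (x y : E) : rieszIso E x y = inner ℂ y x := rfl

/-- The anti-dual is a Hilbert space; its inner product is transported by the Riesz isomorphism,
and its norm is the operator norm. -/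
instance AntiDual.instInnerProductSpace (E : Type*) [NormedAddCommGroup E]
    [InnerProductSpace ℂ E] [CompleteSpace E] : InnerProductSpace ℂ (AntiDual E) :=
  { (inferInstance : NormedSpace ℂ (AntiDual E)) with
    inner := fun f g => inner ℂ ((rieszIso E).symm f) ((rieszIso E).symm g)
    norm_sq_eq_re_inner := fun f => by
      rw [inner_self_eq_norm_sq, LinearIsometryEquiv.norm_map]
    conj_inner_symm := fun f g => by simp
    add_left := fun f g h => by simp
    smul_left := fun f g r => by simp [mul_comm] }

/-- The canonical identification of `E* × F*` with the anti-dual of the Hilbert sum `E × F`: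
`⟨(f, g), (x, y)⟩ = ⟨f, x⟩ + ⟨g, y⟩`. -/
def antiDualProd {E F : Type*} [NormedAddCommGroup E] [InnerProductSpace ℂ E]
    [NormedAddCommGroup F] [InnerProductSpace ℂ F] :
    (AntiDual E × AntiDual F) →ₗ[ℂ] AntiDual (WithLp 2 (E × F)) where
  toFun p := p.1.comp (WithLp.fstL 2 ℂ E F) + p.2.comp (WithLp.sndL 2 ℂ E F)
  map_add' p q := by
    ext x
    simp
    ring
  map_smul' c p := by
    ext x
    simp

theorem antiDualProd_apply {E F : Type*} [NormedAddCommGroup E] [InnerProductSpace ℂ E]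
    [NormedAddCommGroup F] [InnerProductSpace ℂ F] (f : AntiDual E) (g : AntiDual F)
    (x : WithLp 2 (E × F)) : antiDualProd (f, g) x = f x.fst + g x.snd := rfl

/-! ### Semigroups, resolvent sets, boundary nodes -/

/-- A strongly continuous one-parameter semigroup `(T t)`, `t ≥ 0`, of bounded operators
(values at negative `t` are irrelevant). -/
structure IsC0Semigroup {X : Type*} [NormedAddCommGroup X] [InnerProductSpace ℂ X]
    (T : ℝ → X →L[ℂ] X) : Prop where
  map_zero : T 0 = 1
  map_add : ∀ s t : ℝ, 0 ≤ s → 0 ≤ t → T (s + t) = (T s).comp (T t)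
  continuousOn : ∀ x : X, ContinuousOn (fun t => T t x) (Ici 0)

/-- `A` is the generator of a strongly continuous semigroup `T`: `x` lies in the domain of `A`
and `A x = y` if and only if `(T t x - x) / t → y` as `t ↓ 0`. -/
def LinearPMap.GeneratesC0Semigroup {X : Type*} [NormedAddCommGroup X] [InnerProductSpace ℂ X]
    (A : X →ₗ.[ℂ] X) : Prop :=
  ∃ T : ℝ → X →L[ℂ] X, IsC0Semigroup T ∧
    ∀ x y : X, (x, y) ∈ A.graph ↔
      Tendsto (fun t : ℝ => t⁻¹ • (T t x - x)) (𝓝[>] 0) (𝓝 y)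

/-- The resolvent set: all `μ` for which `μ - A : dom A → X` has a bounded everywhere defined
inverse `R`. -/
def LinearPMap.pmapResolventSet {X : Type*} [NormedAddCommGroup X] [InnerProductSpace ℂ X]
    (A : X →ₗ.[ℂ] X) : Set ℂ :=
  {μ | ∃ R : X →L[ℂ] X,
    (∀ x : X, ∃ h : R x ∈ A.domain, μ • R x - A ⟨R x, h⟩ = x) ∧
    (∀ x : A.domain, R (μ • (x : X) - A x) = x)}

/-- A colligation: three linear maps with a common domain `dom` in the state space `X`, with
values in the input space `U`, the state space `X` and the output space `Y`. -/
structure Colligation (U X Y : Type*) [NormedAddCommGroup U] [InnerProductSpace ℂ U]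
    [NormedAddCommGroup X] [InnerProductSpace ℂ X]
    [NormedAddCommGroup Y] [InnerProductSpace ℂ Y] where
  dom : Submodule ℂ X
  G : dom →ₗ[ℂ] U
  L : dom →ₗ[ℂ] X
  K : dom →ₗ[ℂ] Y

namespace Colligation

variable {U X Y : Type*} [NormedAddCommGroup U] [InnerProductSpace ℂ U]
  [NormedAddCommGroup X] [InnerProductSpace ℂ X]
  [NormedAddCommGroup Y] [InnerProductSpace ℂ Y]

/-- The combined operator `z ↦ (G z, L z, K z)`. -/
def combined (Θ : Colligation U X Y) : X →ₗ.[ℂ] (U × X × Y) where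
  domain := Θ.dom
  toFun := Θ.G.prod (Θ.L.prod Θ.K)

/-- The kernel of the input boundary operator, as a subspace of the state space. -/
def kerG (Θ : Colligation U X Y) : Submodule ℂ X :=
  (LinearMap.ker Θ.G).map Θ.dom.subtype

/-- The main operator: the restriction of `L` to `ker G`. -/
def mainOperator (Θ : Colligation U X Y) : X →ₗ.[ℂ] X :=
  (LinearPMap.mk Θ.dom Θ.L).domRestrict Θ.kerG

/-- Boundary nodes. -/
structure IsBoundaryNode (Θ : Colligation U X Y) : Prop where
  closed : Θ.combined.IsClosed
  surjective : Function.Surjective Θ.G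
  dense_ker : Dense (Θ.kerG : Set X)
  resolvent_nonempty : Θ.mainOperator.pmapResolventSet.Nonempty

/-- Internally well-posed boundary nodes. -/
def IsInternallyWellPosed (Θ : Colligation U X Y) : Prop :=
  Θ.IsBoundaryNode ∧ Θ.mainOperator.GeneratesC0Semigroup

/-- Smooth solutions on `[0, ∞)` of `u = G z`, `z' = L z`, `y = K z`: the input is twice
continuously differentiable, `z` is continuously differentiable in `X` and continuous in the
solution space `dom` with the graph norm of the combined operator.  Only times `t ≥ 0` matter. -/
structure IsSmoothSolution (Θ : Colligation U X Y) (u : ℝ → U) (z : ℝ → Θ.dom) (y : ℝ → Y) :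
    Prop where
  input_contDiff : ContDiffOn ℝ 2 u (Ici 0)
  state_contDiff : ContDiffOn ℝ 1 (fun t => (z t : X)) (Ici 0)
  state_continuous : ContinuousOn (fun t => ((z t : X), Θ.G (z t), Θ.L (z t), Θ.K (z t))) (Ici 0)
  input_eq : ∀ t, 0 ≤ t → u t = Θ.G (z t)
  state_eq : ∀ t, 0 ≤ t → HasDerivWithinAt (fun s => (z s : X)) (Θ.L (z t)) (Ici 0) t
  output_eq : ∀ t, 0 ≤ t → y t = Θ.K (z t)

/-- Scattering passive boundary nodes.  The derivative at `t = 0` is the one-sided one. -/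
def IsScatteringPassive (Θ : Colligation U X Y) : Prop :=
  Θ.IsInternallyWellPosed ∧ ∀ u z y, Θ.IsSmoothSolution u z y → ∀ t, 0 ≤ t →
    derivWithin (fun s => ‖(z s : X)‖ ^ 2) (Ici 0) t + ‖y t‖ ^ 2 ≤ ‖u t‖ ^ 2

/-- Scattering energy-preserving boundary nodes. -/
def IsScatteringEnergyPreserving (Θ : Colligation U X Y) : Prop :=
  Θ.IsInternallyWellPosed ∧ ∀ u z y, Θ.IsSmoothSolution u z y → ∀ t, 0 ≤ t →
    derivWithin (fun s => ‖(z s : X)‖ ^ 2) (Ici 0) t + ‖y t‖ ^ 2 = ‖u t‖ ^ 2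

end Colligation

/-! ### Abstract second order systems -/

/-- The data of the second order system: `A : X ⊃ dom A → Y` closed and densely defined, such
that the self-adjoint operator `S = A* A` is uniformly positive, and `B : Y ⊃ dom B → X` closed and
densely defined such that `(A*, -B*)` is a dual pair, i.e. `A* ⊂ -B`. -/
structure SecondOrderSystem (X Y : Type*) [NormedAddCommGroup X] [InnerProductSpace ℂ X]
    [CompleteSpace X] [NormedAddCommGroup Y] [InnerProductSpace ℂ Y] [CompleteSpace Y] where
  A : X →ₗ.[ℂ] Y
  B : Y →ₗ.[ℂ] X
  A_closed : A.IsClosed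
  A_dense : Dense (A.domain : Set X)
  /-- `⟨x, S x⟩ ≥ c ‖x‖²` for `x` in `dom S = {x ∈ dom A | A x ∈ dom A*}`. -/
  uniformly_positive : ∃ c : ℝ, 0 < c ∧ ∀ (x : A.domain) (h : A x ∈ A.adjoint.domain),
    c * ‖(x : X)‖ ^ 2 ≤ (inner ℂ (x : X) (A.adjoint ⟨A x, h⟩)).re
  B_closed : B.IsClosed
  B_dense : Dense (B.domain : Set Y)
  dualPair : A.adjoint ≤ -B

namespace SecondOrderSystem

variable {X Y : Type*} [NormedAddCommGroup X] [InnerProductSpace ℂ X] [CompleteSpace X]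
  [NormedAddCommGroup Y] [InnerProductSpace ℂ Y] [CompleteSpace Y]

/-- Coercivity of the form `⟨A x, A y⟩` on `dom A`: the domain of `S = A* A` is a core for `A`, so
uniform positivity of `S` extends to all of `dom A`. -/
theorem coercive (D : SecondOrderSystem X Y) :
    ∃ c : ℝ, 0 < c ∧ ∀ x : D.A.domain, c * ‖(x : X)‖ ^ 2 ≤ ‖D.A x‖ ^ 2 := by
  obtain ⟨c, hc, hpos⟩ := D.uniformly_positive
  refine ⟨c, hc, fun x₀ => ?_⟩
  let H := WithLp 2 (X × Y)
  let e : H ≃L[ℂ] X × Y := WithLp.prodContinuousLinearEquiv 2 ℂ X Y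
  -- the graph of `A` as a closed subspace of a Hilbert space
  let Γ : Submodule ℂ H := D.A.graph.comap e.toLinearEquiv.toLinearMap
  have hΓmem : ∀ p : H, p ∈ Γ ↔ ∃ x : D.A.domain, (x : X) = p.fst ∧ D.A x = p.snd := by
    intro p
    exact LinearPMap.mem_graph_iff D.A
  have hΓc : IsClosed (Γ : Set H) := D.A_closed.preimage e.continuous
  have : CompleteSpace Γ := hΓc.completeSpace_coe
  -- the part of the graph over the domain of `A* A`
  let W : Submodule ℂ H := Γ ⊓ D.A.adjoint.domain.comap (WithLp.sndL 2 ℂ X Y).toLinearMap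
  have hWΓ : W.topologicalClosure ≤ Γ :=
    Submodule.topologicalClosure_minimal _ inf_le_left hΓc
  have : CompleteSpace W.topologicalClosure :=
    W.isClosed_topologicalClosure.completeSpace_coe
  have hAfa : ∀ (y : D.A.adjoint.domain) (x : D.A.domain),
      inner ℂ (D.A.adjoint y) (x : X) = inner ℂ (y : Y) (D.A x) :=
    LinearPMap.adjoint_isFormalAdjoint D.A_dense
  have hort : W.topologicalClosureᗮ ⊓ Γ = ⊥ := by
    rw [eq_bot_iff]
    rintro v ⟨hv, hvΓ⟩
    obtain ⟨v₁, hv₁, hv₂⟩ := (hΓmem v).1 hvΓ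
    have hvW : ∀ w ∈ W, inner ℂ w v = 0 := fun w hw =>
      (Submodule.mem_orthogonal _ _).1 hv w (W.le_topologicalClosure hw)
    let q : H := WithLp.toLp 2 ((v₁ : X), (0 : Y))
    let p : H := Γ.starProjection q
    have hpΓ : p ∈ Γ := Submodule.starProjection_apply_mem _ _
    have hqp : ∀ w ∈ Γ, inner ℂ (q - p) w = 0 := fun w hw =>
      Submodule.starProjection_inner_eq_zero q w hw
    obtain ⟨p₁, hp₁, hp₂⟩ := (hΓmem p).1 hpΓ
    have hkey : ∀ x : D.A.domain,
        inner ℂ ((v₁ : X) - p₁) (x : X) = inner ℂ (D.A p₁) (D.A x) := by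
      intro x
      have h := hqp (WithLp.toLp 2 ((x : X), D.A x)) ((hΓmem _).2 ⟨x, rfl, rfl⟩)
      rw [WithLp.prod_inner_apply] at h
      change inner ℂ ((v₁ : X) - p.fst) (x : X) + inner ℂ ((0 : Y) - p.snd) (D.A x) = 0 at h
      rw [← hp₁, ← hp₂, zero_sub, inner_neg_left] at h
      exact add_neg_eq_zero.1 h
    have hmem : D.A p₁ ∈ D.A.adjoint.domain :=
      LinearPMap.mem_adjoint_domain_of_exists _ ⟨_, hkey⟩
    have hpW : p ∈ W := ⟨hpΓ, by
      change p.snd ∈ D.A.adjoint.domain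
      rw [← hp₂]; exact hmem⟩
    have h0 := hvW p hpW
    rw [WithLp.prod_inner_apply] at h0
    change inner ℂ p.fst v.fst + inner ℂ p.snd v.snd = 0 at h0
    rw [← hp₁, ← hp₂, ← hv₁, ← hv₂, ← hkey v₁, ← inner_add_left] at h0
    have hz : v₁ = 0 := by
      simpa using h0
    have hv0 : v = 0 := by
      apply (WithLp.prodContinuousLinearEquiv 2 ℂ X Y).injective
      apply Prod.ext
      · change v.fst = 0
        rw [← hv₁, hz]; rfl
      · change v.snd = 0
        rw [← hv₂, hz]; simp
    simp [hv0]
  have heq : W.topologicalClosure = Γ := by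
    have h := Submodule.sup_orthogonal_inf_of_hasOrthogonalProjection hWΓ
    rwa [hort, sup_bot_eq] at h
  have hcl : IsClosed {p : H | c * ‖p.fst‖ ^ 2 ≤ ‖p.snd‖ ^ 2} := by
    have h1 : Continuous fun p : H => p.fst := (WithLp.fstL 2 ℂ X Y).continuous
    have h2 : Continuous fun p : H => p.snd := (WithLp.sndL 2 ℂ X Y).continuous
    exact isClosed_le (by fun_prop) (by fun_prop)
  have hsub : closure (W : Set H) ⊆ {p : H | c * ‖p.fst‖ ^ 2 ≤ ‖p.snd‖ ^ 2} := by
    refine closure_minimal ?_ hcl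
    rintro p ⟨hpΓ, hpd⟩
    obtain ⟨x, hx₁, hx₂⟩ := (hΓmem p).1 hpΓ
    have hd : D.A x ∈ D.A.adjoint.domain := by rw [hx₂]; exact hpd
    have h := hpos x hd
    have h2 := hAfa ⟨D.A x, hd⟩ x
    rw [← inner_conj_symm, h2, Complex.conj_re] at h
    change c * ‖p.fst‖ ^ 2 ≤ ‖p.snd‖ ^ 2
    rw [← hx₁, ← hx₂]
    simpa [inner_self_eq_norm_sq_to_K, ← Complex.ofReal_pow] using h
  have hx₀ : (WithLp.toLp 2 ((x₀ : X), D.A x₀) : H) ∈ Γ := (hΓmem _).2 ⟨x₀, rfl, rfl⟩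
  rw [← heq] at hx₀
  exact hsub hx₀

/-- The energy space `X_h`: the vector space `dom A`, with inner product `⟨A x, A y⟩`. -/
def EnergySpace (D : SecondOrderSystem X Y) : Type _ := D.A.domain

instance (D : SecondOrderSystem X Y) : AddCommGroup D.EnergySpace :=
  inferInstanceAs (AddCommGroup D.A.domain)

instance (D : SecondOrderSystem X Y) : Module ℂ D.EnergySpace :=
  inferInstanceAs (Module ℂ D.A.domain)

/-- The identity, from the energy space to `dom A` as a subspace of `X`. -/
def toDom (D : SecondOrderSystem X Y) : D.EnergySpace ≃ₗ[ℂ] D.A.domain :=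
  LinearEquiv.refl ℂ D.A.domain

/-- `A` as an operator on the energy space. -/
def energyA (D : SecondOrderSystem X Y) : D.EnergySpace →ₗ[ℂ] Y :=
  D.A.toFun ∘ₗ D.toDom.toLinearMap

theorem energyA_injective (D : SecondOrderSystem X Y) : Function.Injective D.energyA := by
  rw [injective_iff_map_eq_zero]
  intro x hx
  obtain ⟨c, hc, h⟩ := D.coercive
  have h1 := h (D.toDom x)
  have hx' : D.A (D.toDom x) = 0 := hx
  rw [hx', norm_zero, zero_pow two_ne_zero] at h1
  have h2 : ‖(D.toDom x : X)‖ ^ 2 ≤ 0 := nonpos_of_mul_nonpos_right h1 hc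
  have h3 : (D.toDom x : X) = 0 := by
    rw [← norm_eq_zero]
    exact pow_eq_zero_iff two_ne_zero |>.1 (le_antisymm h2 (sq_nonneg _))
  exact D.toDom.map_eq_zero_iff.1 (Subtype.ext h3)

/-- The energy norm `‖x‖ = ‖A x‖`. -/
instance (D : SecondOrderSystem X Y) : NormedAddCommGroup D.EnergySpace :=
  NormedAddCommGroup.induced D.EnergySpace Y D.energyA D.energyA_injective

instance (D : SecondOrderSystem X Y) : InnerProductSpace ℂ D.EnergySpace where
  norm_smul_le c x := by
    change ‖D.energyA (c • x)‖ ≤ ‖c‖ * ‖D.energyA x‖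
    rw [map_smul, norm_smul]
  inner x y := inner ℂ (D.energyA x) (D.energyA y)
  norm_sq_eq_re_inner x := by
    rw [inner_self_eq_norm_sq]
    rfl
  conj_inner_symm x y := inner_conj_symm _ _
  add_left x y z := by simp
  smul_left x y r := by simp [mul_comm]

theorem energy_inner (D : SecondOrderSystem X Y) (x y : D.EnergySpace) :
    inner ℂ x y = inner ℂ (D.A (D.toDom x)) (D.A (D.toDom y)) := rfl

instance (D : SecondOrderSystem X Y) : CompleteSpace D.EnergySpace := by
  have hiso : Isometry D.energyA := AddMonoidHomClass.isometry_of_norm _ fun _ => rfl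
  refine Metric.complete_of_cauchySeq_tendsto fun u hu => ?_
  obtain ⟨y, hy⟩ := cauchySeq_tendsto_of_complete (hiso.uniformContinuous.comp_cauchySeq hu)
  obtain ⟨c, hc, hco⟩ := D.coercive
  have hsc : 0 < √c := Real.sqrt_pos.2 hc
  have hb : ∀ x : D.EnergySpace, ‖(D.toDom x : X)‖ ≤ (√c)⁻¹ * ‖x‖ := by
    intro x
    have h := hco (D.toDom x)
    have h2 : √c * ‖(D.toDom x : X)‖ ≤ ‖x‖ := by
      refine le_of_sq_le_sq ?_ (norm_nonneg x)
      rw [mul_pow, Real.sq_sqrt hc.le]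
      exact h
    rw [inv_mul_eq_div, le_div_iff₀ hsc]
    linarith
  let ι : D.EnergySpace →L[ℂ] X :=
    (D.A.domain.subtype ∘ₗ D.toDom.toLinearMap).mkContinuous _ hb
  obtain ⟨x, hx⟩ := cauchySeq_tendsto_of_complete (ι.uniformContinuous.comp_cauchySeq hu)
  have hg : (x, y) ∈ D.A.graph := by
    refine D.A_closed.mem_of_tendsto (hx.prodMk_nhds hy) (Eventually.of_forall fun n => ?_)
    exact LinearPMap.mem_graph D.A (D.toDom (u n))
  obtain ⟨x', -, hx'⟩ := (LinearPMap.mem_graph_iff D.A).1 hg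
  refine ⟨D.toDom.symm x', ?_⟩
  rw [hiso.isEmbedding.tendsto_nhds_iff]
  have : D.energyA (D.toDom.symm x') = y := hx'
  rw [this]
  exact hy

/-- The state space `Z_h = X_h × X`, a Hilbert sum. -/
abbrev StateSpace (D : SecondOrderSystem X Y) : Type _ := WithLp 2 (D.EnergySpace × X)

/-- `dom 𝒜 = {(z₁, z₂) | z₁ ∈ X_h, z₂ ∈ dom A, A z₁ ∈ dom B}`. -/
def maxDomain (D : SecondOrderSystem X Y) : Submodule ℂ D.StateSpace :=
  D.B.domain.comap (D.energyA ∘ₗ (WithLp.fstL 2 ℂ D.EnergySpace X).toLinearMap) ⊓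
    D.A.domain.comap (WithLp.sndL 2 ℂ D.EnergySpace X).toLinearMap

/-- `z ↦ A z₁`, from `dom 𝒜` to `dom B`. -/
def strain (D : SecondOrderSystem X Y) : D.maxDomain →ₗ[ℂ] D.B.domain :=
  LinearMap.codRestrict D.B.domain
    (D.energyA ∘ₗ (WithLp.fstL 2 ℂ D.EnergySpace X).toLinearMap ∘ₗ D.maxDomain.subtype)
    (fun z => z.2.1)

/-- `z ↦ z₂`, from `dom 𝒜` to `dom A`. -/
def velocity (D : SecondOrderSystem X Y) : D.maxDomain →ₗ[ℂ] D.A.domain :=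
  LinearMap.codRestrict D.A.domain
    ((WithLp.sndL 2 ℂ D.EnergySpace X).toLinearMap ∘ₗ D.maxDomain.subtype)
    (fun z => z.2.2)

/-- The maximal operator `𝒜 (z₁, z₂) = (z₂, B A z₁)` on `dom 𝒜`. -/
def maxOperator (D : SecondOrderSystem X Y) : D.StateSpace →ₗ.[ℂ] D.StateSpace where
  domain := D.maxDomain
  toFun := (WithLp.linearEquiv 2 ℂ (D.EnergySpace × X)).symm.toLinearMap ∘ₗ
    (D.toDom.symm.toLinearMap ∘ₗ D.velocity).prod (D.B.toFun ∘ₗ D.strain)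

/-- The minimal operator `𝒜₀ = 𝒜*`. -/
def minOperator (D : SecondOrderSystem X Y) : D.StateSpace →ₗ.[ℂ] D.StateSpace :=
  D.maxOperator.adjoint

theorem maxOperator_apply (D : SecondOrderSystem X Y) (z : D.maxDomain) :
    D.maxOperator z = WithLp.toLp 2 (D.toDom.symm (D.velocity z), D.B (D.strain z)) := rfl

/-- A boundary triplet `((G₁, G₂), Λ, Π)` for the dual pair `(A*, -B*)`, with
`Λ = (Λ₁, Λ₂) : dom A → G₁ × G₂*` and `Π = (Π₁, Π₂) : dom B → G₁* × G₂` surjective and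
`-⟨B y, x⟩ - ⟨y, A x⟩ = ⟨Π₁ y, Λ₁ x⟩ - ⟨Π₂ y, Λ₂ x⟩`, all pairings being linear in the first
argument. -/
structure BoundaryTriplet (D : SecondOrderSystem X Y) (G₁ G₂ : Type*)
    [NormedAddCommGroup G₁] [InnerProductSpace ℂ G₁]
    [NormedAddCommGroup G₂] [InnerProductSpace ℂ G₂] where
  Λ₁ : D.A.domain →ₗ[ℂ] G₁
  Λ₂ : D.A.domain →ₗ[ℂ] AntiDual G₂
  Pi₁ : D.B.domain →ₗ[ℂ] AntiDual G₁
  Pi₂ : D.B.domain →ₗ[ℂ] G₂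
  surjective_Λ : Function.Surjective fun x => (Λ₁ x, Λ₂ x)
  surjective_Pi : Function.Surjective fun y => (Pi₁ y, Pi₂ y)
  green : ∀ (y : D.B.domain) (x : D.A.domain),
    - inner ℂ (x : X) (D.B y) - inner ℂ (D.A x) (y : Y) =
      Pi₁ y (Λ₁ x) - conj (Λ₂ x (Pi₂ y))

namespace BoundaryTriplet

variable {D : SecondOrderSystem X Y} {G₁ G₂ : Type*}
  [NormedAddCommGroup G₁] [InnerProductSpace ℂ G₁]
  [NormedAddCommGroup G₂] [InnerProductSpace ℂ G₂]

/-- `Γ₀ z = (Λ₁ z₂, Π₂ A z₁)`, with values in `G = G₁ × G₂`. -/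
def Γ₀ (T : D.BoundaryTriplet G₁ G₂) : D.maxDomain →ₗ[ℂ] WithLp 2 (G₁ × G₂) :=
  (WithLp.linearEquiv 2 ℂ (G₁ × G₂)).symm.toLinearMap ∘ₗ
    (T.Λ₁ ∘ₗ D.velocity).prod (T.Pi₂ ∘ₗ D.strain)

/-- `Γ₁ z = (-Π₁ A z₁, Λ₂ z₂)`, with values in `G* = G₁* × G₂*`. -/
def Γ₁ (T : D.BoundaryTriplet G₁ G₂) : D.maxDomain →ₗ[ℂ] AntiDual (WithLp 2 (G₁ × G₂)) :=
  antiDualProd ∘ₗ (-(T.Pi₁ ∘ₗ D.strain)).prod (T.Λ₂ ∘ₗ D.velocity)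

variable [CompleteSpace G₁] [CompleteSpace G₂]

/-- `R Γ₀`, with `R` the Riesz isomorphism of `G = G₁ × G₂` onto its anti-dual. -/
def rieszΓ₀ (T : D.BoundaryTriplet G₁ G₂) : D.maxDomain →ₗ[ℂ] AntiDual (WithLp 2 (G₁ × G₂)) :=
  (rieszIso (WithLp 2 (G₁ × G₂))).toLinearEquiv.toLinearMap ∘ₗ T.Γ₀

/-- The colligation with input `(1/√2) (R Γ₀ + Γ₁)`, interior operator `𝒜` and output
`-(1/√2) P (R Γ₀ - Γ₁)`. -/
def colligation (T : D.BoundaryTriplet G₁ G₂)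
    (P : AntiDual (WithLp 2 (G₁ × G₂)) →L[ℂ] AntiDual (WithLp 2 (G₁ × G₂))) :
    Colligation (AntiDual (WithLp 2 (G₁ × G₂))) D.StateSpace
      (AntiDual (WithLp 2 (G₁ × G₂))) where
  dom := D.maxDomain
  G := (1 / ((√2 : ℝ) : ℂ)) • (T.rieszΓ₀ + T.Γ₁)
  L := D.maxOperator.toFun
  K := (-1 / ((√2 : ℝ) : ℂ)) • (P.toLinearMap ∘ₗ (T.rieszΓ₀ - T.Γ₁))

end BoundaryTriplet

end SecondOrderSystem

end

open Set Filter Topology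
open scoped ComplexConjugate InnerProductSpace

noncomputable section

/-! ### Generation of contraction semigroups -/

section ContractionExponential

variable {E : Type*} [NormedAddCommGroup E] [NormedSpace ℂ E]

/-! Put Gp = (RΓ₀ + Γ₁)/√2 (incoming wave) and Gm = (RΓ₀ - Γ₁)/√2 (outgoing wave), and let M be the
maximal operator. Polarization turns Green's formula for the triplet into ⟨Mz, w⟩ + ⟨z, Mw⟩ = ⟨Gp z,
Gp w⟩ - ⟨Gm z, Gm w⟩. With joint surjectivity of (Gp, Gm), and with the fact that M contains the
negative adjoint of its restriction M₀ to ker Gp ∩ ker Gm, this is all the theorem needs;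
`IsScatteringTriple` records these three properties.

They make M closed with M** = M, and M restricted to ker Gp maximal dissipative, so it generates a
contraction semigroup by Lumer–Phillips (proved here with bounded Yosida approximations). The closed
graph theorem makes the boundary maps continuous in the graph norm, so the node is internally
well-posed for every P.

Along a smooth solution the balance reads d/dt ‖z‖² + ‖y‖² = ‖u‖² - (‖Gm z‖² - ‖P Gm z‖²).
Sufficiency of the conditions on P is immediate. For necessity every g must occur as Gm z(0). Since
(-M, Gm, Gp) is again such a triple, 1 + M maps ker Gm onto the state space; hence every g is the
outgoing wave of some z with Mz = -z, and e^{-t} z is a smooth solution.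

For the second order system, the three properties follow from A* ⊂ -B and the splitting Y = ran A ⊕
(ran A)^⊥. The second summand lies in ker B, and Π vanishes on it, so restricting B to ran A loses
no boundary values. -/

theorem norm_exp_smul_le_of_norm_le_one (J : E →L[ℂ] E) (hJ : ‖J‖ ≤ 1) {r : ℝ} (hr : 0 ≤ r) :
    ‖NormedSpace.exp (r • J)‖ ≤ Real.exp r := by
  have hpow : ∀ n : ℕ, ‖J ^ n‖ ≤ 1 := by
    intro n
    induction n with
    | zero => rw [pow_zero]; exact ContinuousLinearMap.norm_id_le
    | succ n ih =>
      rw [pow_succ]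
      exact (norm_mul_le _ _).trans (mul_le_one₀ ih (norm_nonneg _) hJ)
  rw [NormedSpace.exp_eq_tsum ℝ, Real.exp_eq_exp_ℝ]
  refine tsum_of_norm_bounded (NormedSpace.exp_series_hasSum_exp' (𝕂 := ℝ) r) fun n => ?_
  rw [smul_pow, norm_smul, norm_smul, norm_pow, Real.norm_of_nonneg hr,
    Real.norm_of_nonneg (by positivity), smul_eq_mul]
  exact mul_le_mul_of_nonneg_left (mul_le_of_le_one_right (by positivity) (hpow n)) (by positivity)

variable [CompleteSpace E]

theorem hasDerivAt_exp_smul_apply (S : E →L[ℂ] E) (x : E) (t : ℝ) :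
    HasDerivAt (fun s : ℝ => NormedSpace.exp (s • S) x) (NormedSpace.exp (t • S) (S x)) t := by
  have h := hasDerivAt_exp_smul_const (𝕂 := ℝ) S t
  have h2 := ((ContinuousLinearMap.apply ℂ E x).restrictScalars ℝ).hasFDerivAt.comp_hasDerivAt t h
  exact h2

/-- The scalar factor exp(-tc) splits off and cancels the growth bound exp(tc) of exp(tcJ). Yosida
approximations have exactly this form. -/
theorem norm_exp_smul_sub_one_le (J : E →L[ℂ] E) (hJ : ‖J‖ ≤ 1) {t c : ℝ} (ht : 0 ≤ t)
    (hc : 0 ≤ c) : ‖NormedSpace.exp (t • (c • (J - 1)))‖ ≤ 1 := by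
  let : NormedAlgebra ℚ (E →L[ℂ] E) := NormedAlgebra.restrictScalars ℚ ℝ _
  have h1 : t • (c • (J - 1)) = (t * c) • J + (-(t * c)) • (1 : E →L[ℂ] E) := by
    rw [smul_smul, smul_sub, neg_smul, sub_eq_add_neg]
  have hcomm : Commute ((t * c) • J) ((-(t * c)) • (1 : E →L[ℂ] E)) :=
    ((Commute.one_right J).smul_left _).smul_right _
  have h2 : NormedSpace.exp ((-(t * c)) • (1 : E →L[ℂ] E)) = Real.exp (-(t * c)) • 1 := by
    rw [← Algebra.algebraMap_eq_smul_one, ← NormedSpace.algebraMap_exp_comm, Real.exp_eq_exp_ℝ,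
      Algebra.algebraMap_eq_smul_one]
  rw [h1, NormedSpace.exp_add_of_commute hcomm, h2, mul_smul_comm, mul_one, norm_smul,
    Real.norm_eq_abs, abs_of_pos (Real.exp_pos _)]
  have h3 := norm_exp_smul_le_of_norm_le_one J hJ (mul_nonneg ht hc)
  calc _ ≤ Real.exp (-(t * c)) * Real.exp (t * c) := by gcongr
    _ = 1 := by rw [← Real.exp_add]; simp

/-- The path s ↦ exp(sS) exp((t-s)S') x joins the two vectors. By commutativity its derivative is a
product of two contractions applied to Sx - S'x, so the mean value inequality applies. -/
theorem norm_exp_smul_apply_sub_le {S S' : E →L[ℂ] E} (h : Commute S S')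
    (hS : ∀ t : ℝ, 0 ≤ t → ‖NormedSpace.exp (t • S)‖ ≤ 1)
    (hS' : ∀ t : ℝ, 0 ≤ t → ‖NormedSpace.exp (t • S')‖ ≤ 1) {t : ℝ} (ht : 0 ≤ t) (x : E) :
    ‖NormedSpace.exp (t • S) x - NormedSpace.exp (t • S') x‖ ≤ t * ‖S x - S' x‖ := by
  let f : ℝ → E := fun s => (NormedSpace.exp (s • S) * NormedSpace.exp ((t - s) • S')) x
  have hf : ∀ s, HasDerivAt f
      (NormedSpace.exp (s • S) (NormedSpace.exp ((t - s) • S') (S x - S' x))) s := by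
    intro s
    have h1 := hasDerivAt_exp_smul_const (𝕂 := ℝ) S s
    have h2 := (hasDerivAt_exp_smul_const (𝕂 := ℝ) S' (t - s)).scomp s
      ((hasDerivAt_id s).const_sub t)
    have h3 := ((ContinuousLinearMap.apply ℂ E x).restrictScalars ℝ).hasFDerivAt.comp_hasDerivAt s
      (h1.mul h2)
    have hc : S * NormedSpace.exp ((t - s) • S') = NormedSpace.exp ((t - s) • S') * S :=
      ((h.smul_right (t - s)).exp_right).eq
    refine h3.congr_deriv ?_
    have hc' : S (NormedSpace.exp ((t - s) • S') x) = NormedSpace.exp ((t - s) • S') (S x) :=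
      congrArg (fun V : E →L[ℂ] E => V x) hc
    simp only [ContinuousLinearMap.coe_restrictScalars', ContinuousLinearMap.apply_apply]
    simp [sub_eq_add_neg]
    rw [← sub_eq_add_neg, hc']
  have hb := (convex_Icc (0 : ℝ) t).norm_image_sub_le_of_norm_hasDerivWithin_le (f := f)
    (C := ‖S x - S' x‖) (fun s _ => (hf s).hasDerivWithinAt) (fun s hs => ?_)
    (left_mem_Icc.2 ht) (right_mem_Icc.2 ht)
  · have e1 : f t = NormedSpace.exp (t • S) x := by simp [f]
    have e0 : f 0 = NormedSpace.exp (t • S') x := by simp [f]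
    rw [e1, e0, sub_zero, Real.norm_of_nonneg ht, mul_comm] at hb
    exact hb
  · calc _ ≤ 1 * (1 * ‖S x - S' x‖) := by
          refine (ContinuousLinearMap.le_of_opNorm_le _ (hS s hs.1) _).trans ?_
          gcongr
          exact ContinuousLinearMap.le_of_opNorm_le _ (hS' _ (sub_nonneg.2 hs.2)) _
      _ = _ := by ring

theorem norm_exp_smul_apply_sub_self_le {S : E →L[ℂ] E}
    (hS : ∀ t : ℝ, 0 ≤ t → ‖NormedSpace.exp (t • S)‖ ≤ 1) {t : ℝ} (ht : 0 ≤ t) (x : E) :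
    ‖NormedSpace.exp (t • S) x - x‖ ≤ t * ‖S x‖ := by
  have h := norm_exp_smul_apply_sub_le (Commute.zero_right S) hS
    (fun t _ => by
      rw [smul_zero, NormedSpace.exp_zero]; exact ContinuousLinearMap.norm_id_le) ht x
  simpa using h

/-- Mean value inequality for s ↦ exp(sS)x - sSx. The estimate survives the limit of the
approximations and identifies the generator. -/
theorem norm_exp_smul_apply_sub_self_sub_le {S : E →L[ℂ] E} {t : ℝ} (ht : 0 ≤ t) (x : E) {C : ℝ}
    (hC : ∀ s ∈ Icc 0 t, ‖NormedSpace.exp (s • S) (S x) - S x‖ ≤ C) :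
    ‖NormedSpace.exp (t • S) x - x - t • S x‖ ≤ t * C := by
  have hb := (convex_Icc (0 : ℝ) t).norm_image_sub_le_of_norm_hasDerivWithin_le
    (f := fun s => NormedSpace.exp (s • S) x - s • S x) (C := C)
    (fun s _ => ((hasDerivAt_exp_smul_apply S x s).sub
      ((hasDerivAt_id s).smul_const (S x))).hasDerivWithinAt)
    (fun s hs => by simpa using hC s hs) (left_mem_Icc.2 ht) (right_mem_Icc.2 ht)
  simp only [zero_smul, NormedSpace.exp_zero, sub_zero, Real.norm_of_nonneg ht] at hb
  rw [mul_comm, sub_right_comm]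
  exact hb

end ContractionExponential

/-! ### Strong limits of contractions -/

section Limit

variable {E : Type*} [NormedAddCommGroup E] [NormedSpace ℂ E]

/-- Contractions that converge strongly on a dense subspace converge strongly. -/
theorem cauchySeq_apply_of_dense {D : Submodule ℂ E} (hD : Dense (D : Set E))
    {V : ℕ → E →L[ℂ] E} (hV : ∀ n, ‖V n‖ ≤ 1) (h : ∀ x ∈ D, CauchySeq fun n => V n x) (x : E) :
    CauchySeq fun n => V n x := by
  rw [Metric.cauchySeq_iff]
  intro ε hε
  obtain ⟨w, hw, hxw⟩ := Metric.dense_iff.1 hD x (ε / 3) (by positivity)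
  obtain ⟨N, hN⟩ := Metric.cauchySeq_iff.1 (h w hxw) (ε / 3) (by positivity)
  refine ⟨N, fun m hm n hn => ?_⟩
  have hV' : ∀ n, dist (V n x) (V n w) < ε / 3 := fun n => by
    rw [dist_eq_norm, ← map_sub]
    refine (ContinuousLinearMap.le_of_opNorm_le _ (hV n) _).trans_lt ?_
    rw [one_mul, ← dist_eq_norm, dist_comm]
    exact hw
  have h1 := dist_triangle4 (V m x) (V m w) (V n w) (V n x)
  have h2 := hV' n
  rw [dist_comm] at h2
  linarith [hV' m, hN m hm n hn]

theorem tendsto_apply_of_dense {D : Submodule ℂ E} (hD : Dense (D : Set E)) {V : ℕ → E →L[ℂ] E}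
    (hV : ∀ n, ‖V n‖ ≤ 1) (h : ∀ x ∈ D, Tendsto (fun n => V n x) atTop (𝓝 x)) (x : E) :
    Tendsto (fun n => V n x) atTop (𝓝 x) := by
  rw [Metric.tendsto_atTop]
  intro ε hε
  obtain ⟨w, hw, hxw⟩ := Metric.dense_iff.1 hD x (ε / 3) (by positivity)
  obtain ⟨N, hN⟩ := Metric.tendsto_atTop.1 (h w hxw) (ε / 3) (by positivity)
  refine ⟨N, fun n hn => ?_⟩
  have h1 := dist_triangle4 (V n x) (V n w) w x
  have h2 : dist (V n x) (V n w) ≤ dist x w := by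
    rw [dist_eq_norm, dist_eq_norm, ← map_sub]
    simpa using ContinuousLinearMap.le_of_opNorm_le _ (hV n) (x - w)
  have h3 : dist w x < ε / 3 := hw
  have h4 := hN n hn
  linarith [dist_comm w x]

end Limit

/-! ### Dissipative operators, their resolvents and Yosida approximations -/

namespace LinearPMap

variable {X : Type*} [NormedAddCommGroup X] [InnerProductSpace ℂ X] {A : X →ₗ.[ℂ] X}

/-- Dissipative operators: `Re ⟨x, A x⟩ ≤ 0` on the domain. -/
def IsDissipative (A : X →ₗ.[ℂ] X) : Prop :=
  ∀ x : A.domain, (inner ℂ (x : X) (A x)).re ≤ 0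

/-- Dissipativity gives l‖x‖² ≤ Re⟨x, (l - A)x⟩; Cauchy–Schwarz does the rest. -/
theorem IsDissipative.norm_le (hA : A.IsDissipative) {l : ℝ} (hl : 0 < l) (x : A.domain) :
    ‖(x : X)‖ ≤ l⁻¹ * ‖(l : ℂ) • (x : X) - A x‖ := by
  have h1 : (inner ℂ (x : X) ((l : ℂ) • (x : X) - A x)).re =
      l * ‖(x : X)‖ ^ 2 - (inner ℂ (x : X) (A x)).re := by
    rw [inner_sub_right, inner_smul_right, inner_self_eq_norm_sq_to_K]
    simp [← Complex.ofReal_pow]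
  have h2 : l * ‖(x : X)‖ ^ 2 ≤ ‖(x : X)‖ * ‖(l : ℂ) • (x : X) - A x‖ := by
    have h3 := (Complex.re_le_norm _).trans
      (norm_inner_le_norm (𝕜 := ℂ) (x : X) ((l : ℂ) • (x : X) - A x))
    linarith [hA x]
  rw [inv_mul_eq_div, le_div_iff₀ hl]
  rcases (norm_nonneg (x : X)).eq_or_lt with h | h
  · rw [← h, zero_mul]; exact norm_nonneg _
  · refine le_of_mul_le_mul_left ?_ h
    linarith

/-- The resolvent of a dissipative operator at a positive number. -/
theorem IsDissipative.exists_resolvent (hA : A.IsDissipative) {l : ℝ} (hl : 0 < l)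
    (hr : ∀ y, ∃ x : A.domain, (l : ℂ) • (x : X) - A x = y) :
    ∃ R : X →L[ℂ] X, (∀ x, ∃ h : R x ∈ A.domain, (l : ℂ) • R x - A ⟨R x, h⟩ = x) ∧
      (∀ x : A.domain, R ((l : ℂ) • (x : X) - A x) = x) ∧ ‖R‖ ≤ l⁻¹ := by
  let V : A.domain →ₗ[ℂ] X := (l : ℂ) • A.domain.subtype - A.toFun
  have hV : ∀ x, V x = (l : ℂ) • (x : X) - A x := fun _ => rfl
  have hinj : Function.Injective V := by
    rw [injective_iff_map_eq_zero]
    intro x hx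
    have h := hA.norm_le hl x
    rw [← hV, hx, norm_zero, mul_zero] at h
    exact Subtype.ext (norm_le_zero_iff.1 h)
  let e : A.domain ≃ₗ[ℂ] X := LinearEquiv.ofBijective V ⟨hinj, hr⟩
  have he : ∀ y, V (e.symm y) = y := e.apply_symm_apply
  refine ⟨(A.domain.subtype ∘ₗ e.symm.toLinearMap).mkContinuous l⁻¹ fun y => ?_,
    fun x => ⟨(e.symm x).2, he x⟩, fun x => ?_,
    LinearMap.mkContinuous_norm_le _ (inv_nonneg.2 hl.le) _⟩
  · refine (hA.norm_le hl (e.symm y)).trans_eq ?_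
    rw [← hV, he]
  · exact congrArg Subtype.val (e.symm_apply_apply x)

/-- The domain of a dissipative operator with `1 - A` surjective is dense. -/
theorem IsDissipative.dense_domain [CompleteSpace X] (hA : A.IsDissipative)
    (hr : ∀ y, ∃ x : A.domain, (x : X) - A x = y) : Dense (A.domain : Set X) := by
  rw [Submodule.dense_iff_topologicalClosure_eq_top, Submodule.topologicalClosure_eq_top_iff,
    Submodule.eq_bot_iff]
  intro v hv
  -- A vector orthogonal to the domain has the form w - Aw; testing with w gives ‖w‖² = ⟨w, Aw⟩,
  -- whose real part is nonpositive.
  obtain ⟨w, rfl⟩ := hr v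
  have h0 := (Submodule.mem_orthogonal _ _).1 hv w w.2
  rw [inner_sub_right, inner_self_eq_norm_sq_to_K, sub_eq_zero] at h0
  have h1 := hA w
  rw [← h0] at h1
  have h2 : ‖(w : X)‖ ^ 2 ≤ 0 := by simpa [← Complex.ofReal_pow] using h1
  have h3 : (w : X) = 0 := by
    rw [← norm_eq_zero]
    exact pow_eq_zero_iff two_ne_zero |>.1 (le_antisymm h2 (sq_nonneg _))
  have h4 : w = 0 := Subtype.ext h3
  simp [h4]

/-- Bounded approximations of a maximal dissipative operator. -/
theorem IsDissipative.exists_yosida [CompleteSpace X] (hA : A.IsDissipative)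
    (hr : ∀ l : ℝ, 0 < l → ∀ y, ∃ x : A.domain, (l : ℂ) • (x : X) - A x = y)
    (hd : Dense (A.domain : Set X)) :
    ∃ S : ℕ → X →L[ℂ] X, (∀ n, ∀ t : ℝ, 0 ≤ t → ‖NormedSpace.exp (t • S n)‖ ≤ 1) ∧
      (∀ m n, Commute (S m) (S n)) ∧
      (∀ x : A.domain, Tendsto (fun n => S n x) atTop (𝓝 (A x))) ∧
      ∀ (x : A.domain) n, ‖S n x‖ ≤ ‖A x‖ := by
  -- The shift by one keeps every l n positive. Injectivity of l serves the commutation of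
  -- resolvents, and 1 / l n → 0 the convergence of J n.
  obtain ⟨l, hl⟩ : ∃ l : ℕ → ℝ, ∀ n, l n = n + 1 := ⟨_, fun _ => rfl⟩
  have hpos : ∀ n, 0 < l n := fun n => by rw [hl]; positivity
  choose R hR1 hR2 hR3 using fun n => hA.exists_resolvent (hpos n) (hr _ (hpos n))
  let J : ℕ → X →L[ℂ] X := fun n => l n • R n
  have hJ : ∀ n, ‖J n‖ ≤ 1 := fun n => by
    rw [norm_smul, Real.norm_of_nonneg (hpos n).le]
    calc _ ≤ l n * (l n)⁻¹ := mul_le_mul_of_nonneg_left (hR3 n) (hpos n).le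
      _ = 1 := mul_inv_cancel₀ (hpos n).ne'
  have hRR : ∀ m n, Commute (R m) (R n) := by
    intro m n
    -- The resolvent identity. Adding it to its mirror image gives commutation after division by l m
    -- - l n.
    have key : ∀ m n : ℕ, ∀ x, R m x + ((l m : ℂ) - l n) • R m (R n x) =
        R n x := by
      intro m n x
      obtain ⟨h, hx⟩ := hR1 n x
      have h1 := hR2 m ⟨R n x, h⟩
      have h2 : (l m : ℂ) • R n x - A ⟨R n x, h⟩ =
          x + ((l m : ℂ) - l n) • R n x := by
        nth_rewrite 3 [← hx]
        rw [sub_smul]; abel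
      rw [h2, _root_.map_add, _root_.map_smul] at h1
      exact h1
    rcases eq_or_ne m n with rfl | hmn
    · exact Commute.refl _
    ext x
    have h1 := key m n x
    have h2 := key n m x
    have h3 : ((l m : ℂ) - l n) • (R m (R n x) - R n (R m x)) = 0 := by
      have h4 : ((l m : ℂ) - l n) • R m (R n x) = R n x - R m x := by
        rw [eq_sub_iff_add_eq, add_comm, h1]
      have h5 : ((l n : ℂ) - l m) • R n (R m x) = R m x - R n x := by
        rw [eq_sub_iff_add_eq, add_comm, h2]
      rw [smul_sub, h4, ← neg_sub (l n : ℂ), neg_smul, h5]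
      abel
    rw [smul_eq_zero, sub_eq_zero, sub_eq_zero] at h3
    rcases h3 with h3 | h3
    · rw [Complex.ofReal_inj, hl, hl, add_left_inj, Nat.cast_inj] at h3
      exact absurd h3 hmn
    · exact h3
  -- On dom A the Yosida approximation is J n A. Since J n is a contraction tending strongly to 1,
  -- this gives both the convergence to A and the uniform bound.
  have hJA : ∀ (n : ℕ) (x : A.domain), (l n • (J n - 1)) (x : X) = J n (A x) := by
    intro n x
    have h := hR2 n x
    rw [_root_.map_sub, _root_.map_smul] at h
    have h' : R n (A x) = (l n : ℂ) • R n x - x := by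
      rw [eq_sub_iff_add_eq, add_comm, ← eq_sub_iff_add_eq, h]
    simp only [J, _root_.smul_apply, _root_.sub_apply,
      one_apply_eq_self, h', ← Complex.coe_smul]
  have hJx : ∀ x, Tendsto (fun n => J n x) atTop (𝓝 x) := by
    refine tendsto_apply_of_dense hd hJ fun x hx => ?_
    rw [tendsto_iff_norm_sub_tendsto_zero]
    have h0 : Tendsto (fun n : ℕ => 1 / l n * ‖A ⟨x, hx⟩‖) atTop (𝓝 0) := by
      simpa [hl] using (tendsto_one_div_add_atTop_nhds_zero_nat (𝕜 := ℝ)).mul_const ‖A ⟨x, hx⟩‖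
    refine squeeze_zero (fun _ => norm_nonneg _) (fun n => ?_) h0
    have h1 := congrArg norm (hJA n ⟨x, hx⟩)
    rw [_root_.smul_apply, norm_smul, Real.norm_of_nonneg (hpos n).le] at h1
    have h2 := ContinuousLinearMap.le_of_opNorm_le _ (hJ n) (A ⟨x, hx⟩)
    rw [← h1, one_mul] at h2
    rw [one_div, inv_mul_eq_div, le_div_iff₀ (hpos n), mul_comm]
    exact h2
  refine ⟨fun n => l n • (J n - 1),
    fun n t ht => norm_exp_smul_sub_one_le _ (hJ n) ht (hpos n).le, fun m n => ?_,
    fun x => ?_, fun x n => ?_⟩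
  · have h : Commute (J m) (J n) := ((hRR m n).smul_left _).smul_right _
    exact (((h.sub_left (Commute.one_left _)).sub_right
      ((Commute.one_right _))).smul_left _).smul_right _
  · exact (hJx _).congr fun n => (hJA n x).symm
  · rw [hJA]
    simpa using ContinuousLinearMap.le_of_opNorm_le _ (hJ n) (A x)

end LinearPMap

/-- The strong limit of contraction semigroups `exp (t S n)` with commuting bounded generators
that converge strongly on a dense subspace. -/
theorem exists_strong_limit_exp {E : Type*} [NormedAddCommGroup E] [NormedSpace ℂ E]
    [CompleteSpace E] {D : Submodule ℂ E} (hD : Dense (D : Set E)) {S : ℕ → E →L[ℂ] E}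
    (hS : ∀ n, ∀ t : ℝ, 0 ≤ t → ‖NormedSpace.exp (t • S n)‖ ≤ 1)
    (hc : ∀ m n, Commute (S m) (S n)) (hl : ∀ x ∈ D, CauchySeq fun n => S n x) :
    ∃ T : ℝ → E →L[ℂ] E, ∀ t, 0 ≤ t → ∀ x,
      Tendsto (fun n => NormedSpace.exp (t • S n) x) atTop (𝓝 (T t x)) := by
  -- Replacing t by max t 0 makes the limit exist for every real t, so the choice of limits is
  -- total.
  have h : ∀ (t : ℝ) (x : E), ∃ y,
      Tendsto (fun n => NormedSpace.exp (max t 0 • S n) x) atTop (𝓝 y) := by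
    intro t x
    have ht : 0 ≤ max t 0 := le_max_right _ _
    refine cauchySeq_tendsto_of_complete
      (cauchySeq_apply_of_dense hD (fun n => hS n _ ht) (fun x hx => ?_) x)
    have h1 := (cauchySeq_iff_tendsto_dist_atTop_0.1 (hl x hx)).const_mul (max t 0)
    rw [mul_zero] at h1
    refine cauchySeq_iff_tendsto_dist_atTop_0.2 (squeeze_zero (fun _ => dist_nonneg)
      (fun p => ?_) h1)
    rw [dist_eq_norm, dist_eq_norm]
    exact norm_exp_smul_apply_sub_le (hc p.1 p.2) (hS _) (hS _) ht x
  choose F hF using h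
  refine ⟨fun t => continuousLinearMapOfTendsto (fun n => NormedSpace.exp (max t 0 • S n))
    (tendsto_pi_nhds.2 (hF t)), fun t ht x => ?_⟩
  have h1 := hF t x
  rw [max_eq_left ht] at h1
  exact h1

namespace LinearPMap

variable {X : Type*} [NormedAddCommGroup X] [InnerProductSpace ℂ X] [CompleteSpace X]
  {A : X →ₗ.[ℂ] X}

/-- The Lumer–Phillips theorem in Hilbert spaces. -/
theorem IsDissipative.generatesC0Semigroup (hA : A.IsDissipative)
    (hr : ∀ l : ℝ, 0 < l → ∀ y, ∃ x : A.domain, (l : ℂ) • (x : X) - A x = y) :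
    A.GeneratesC0Semigroup := by
  have hr1 : ∀ y, ∃ x : A.domain, (x : X) - A x = y := by simpa using hr 1 one_pos
  have hd := hA.dense_domain hr1
  obtain ⟨S, hS, hc, hSA, hSle⟩ := hA.exists_yosida hr hd
  obtain ⟨T, hT⟩ := exists_strong_limit_exp hd hS hc fun x hx => (hSA ⟨x, hx⟩).cauchySeq
  have hT1 : ∀ t, 0 ≤ t → ∀ x, ‖T t x‖ ≤ ‖x‖ := fun t ht x =>
    le_of_tendsto' (hT t ht x).norm fun n => by
      simpa using ContinuousLinearMap.le_of_opNorm_le _ (hS n t ht) x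
  have hT0 : T 0 = 1 := by
    ext x
    refine tendsto_nhds_unique (hT 0 le_rfl x) ?_
    simp
  have hadd : ∀ s t : ℝ, 0 ≤ s → 0 ≤ t → T (s + t) = (T s).comp (T t) := by
    intro s t hs ht
    ext x
    refine tendsto_nhds_unique (hT _ (add_nonneg hs ht) x) ?_
    -- Both factors depend on n. Contractivity of the outer one lets the inner one be replaced by
    -- its limit.
    have h1 : ∀ n, NormedSpace.exp ((s + t) • S n) x =
        NormedSpace.exp (s • S n) (NormedSpace.exp (t • S n) x - T t x) +
          NormedSpace.exp (s • S n) (T t x) := by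
      intro n
      let : NormedAlgebra ℚ (X →L[ℂ] X) := NormedAlgebra.restrictScalars ℚ ℝ _
      rw [add_smul, NormedSpace.exp_add_of_commute
        (((Commute.refl (S n)).smul_left s).smul_right t), _root_.map_sub, sub_add_cancel]
      rfl
    have h2 : Tendsto (fun n => NormedSpace.exp (s • S n) (NormedSpace.exp (t • S n) x - T t x))
        atTop (𝓝 0) := by
      have h3 := tendsto_iff_norm_sub_tendsto_zero.1 (hT t ht x)
      refine squeeze_zero_norm (fun n => ?_) h3
      simpa using ContinuousLinearMap.le_of_opNorm_le _ (hS n s hs)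
        (NormedSpace.exp (t • S n) x - T t x)
    have h4 := h2.add (hT s hs (T t x))
    rw [zero_add] at h4
    exact h4.congr fun n => (h1 n).symm
  have hsub : ∀ t, 0 ≤ t → ∀ x : A.domain, ‖T t x - x‖ ≤ t * ‖A x‖ := fun t ht x =>
    le_of_tendsto' ((hT t ht x).sub_const _).norm fun n =>
      (norm_exp_smul_apply_sub_self_le (hS n) ht _).trans
        (mul_le_mul_of_nonneg_left (hSle x n) ht)
  have hdist : ∀ s t, 0 ≤ s → s ≤ t → ∀ x : A.domain,
      dist (T s x) (T t x) ≤ ‖A x‖ * dist s t := by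
    intro s t hs hst x
    have h1 := hadd s (t - s) hs (sub_nonneg.2 hst)
    rw [add_sub_cancel] at h1
    rw [dist_comm, dist_eq_norm, h1, ContinuousLinearMap.comp_apply, ← _root_.map_sub, dist_comm,
      Real.dist_eq, abs_of_nonneg (sub_nonneg.2 hst), mul_comm]
    exact (hT1 s hs _).trans (hsub _ (sub_nonneg.2 hst) x)
  have hcont_dom : ∀ x : A.domain, ContinuousOn (fun t => T t x) (Ici 0) := by
    intro x
    refine (LipschitzOnWith.of_dist_le_mul (K := ‖A x‖₊) fun s hs t ht => ?_).continuousOn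
    rcases le_total s t with h | h
    · exact hdist s t hs h x
    · rw [dist_comm, dist_comm s]
      exact hdist t s ht h x
  have hcont : ∀ x, ContinuousOn (fun t => T t x) (Ici 0) := by
    intro x
    refine continuousOn_of_uniform_approx_of_continuousOn fun u hu => ?_
    obtain ⟨ε, hε, hu⟩ := Metric.mem_uniformity_dist.1 hu
    obtain ⟨w, hxw, hw⟩ := Metric.dense_iff.1 hd x ε hε
    refine ⟨fun t => T t w, hcont_dom ⟨w, hw⟩, fun t ht => hu ?_⟩
    rw [dist_eq_norm, ← _root_.map_sub]
    refine (hT1 t ht _).trans_lt ?_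
    rw [← dist_eq_norm, dist_comm]
    exact hxw
  -- Ax need not lie in the domain, so it is approximated by w in the domain, where exp(sS n)w - w
  -- is of order s uniformly in n.
  have hderiv_le : ∀ t, 0 ≤ t → ∀ x w : A.domain,
      ‖T t x - x - t • A x‖ ≤ t * (2 * ‖A x - w‖ + t * ‖A w‖) := by
    intro t ht x w
    refine le_of_tendsto_of_tendsto' (((hT t ht x).sub_const _).sub ((hSA x).const_smul t)).norm
      (((((hSA x).sub_const (w : X)).norm.const_mul 2).add
        ((hSA w).norm.const_mul t)).const_mul t) fun n => ?_
    refine norm_exp_smul_apply_sub_self_sub_le ht _ fun s hs => ?_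
    have h1 : NormedSpace.exp (s • S n) (S n x) - S n x =
        NormedSpace.exp (s • S n) (S n x - w) + (NormedSpace.exp (s • S n) w - w) -
          (S n x - w) := by
      rw [_root_.map_sub]; abel
    have h2 := ContinuousLinearMap.le_of_opNorm_le _ (hS n s hs.1) (S n x - w)
    have h3 := norm_exp_smul_apply_sub_self_le (hS n) hs.1 (w : X)
    have h4 := mul_le_mul_of_nonneg_right hs.2 (norm_nonneg (S n w))
    rw [h1]
    refine (norm_sub_le _ _).trans ((add_le_add_left (norm_add_le _ _) _).trans ?_)
    linarith
  have hgen : ∀ x : A.domain, Tendsto (fun t : ℝ => t⁻¹ • (T t x - x)) (𝓝[>] 0) (𝓝 (A x)) := by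
    intro x
    rw [Metric.tendsto_nhdsWithin_nhds]
    intro ε hε
    -- The error splits as 2 · ε/4 from w and less than ε/2 from t‖Aw‖; the added 1 in the radius
    -- below avoids division by zero.
    obtain ⟨w, hxw, hw⟩ := Metric.dense_iff.1 hd (A x) (ε / 4) (by positivity)
    have hN : 0 < ‖A ⟨w, hw⟩‖ + 1 := by positivity
    refine ⟨ε / 2 / (‖A ⟨w, hw⟩‖ + 1), by positivity, fun t ht htd => ?_⟩
    have ht : 0 < t := ht
    have h1 := hderiv_le t ht.le x ⟨w, hw⟩
    rw [Real.dist_eq, sub_zero, abs_of_pos ht, lt_div_iff₀ hN] at htd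
    have h2 : t⁻¹ • (T t x - x) - A x = t⁻¹ • (T t x - x - t • A x) := by
      rw [smul_sub _ _ (t • A x), smul_smul, inv_mul_cancel₀ ht.ne', one_smul]
    rw [dist_eq_norm, h2, norm_smul, Real.norm_of_nonneg (inv_nonneg.2 ht.le), inv_mul_eq_div,
      div_lt_iff₀ ht, mul_comm]
    refine h1.trans_lt (mul_lt_mul_of_pos_left ?_ ht)
    have h3 : ‖A x - w‖ < ε / 4 := by rw [← dist_eq_norm, dist_comm]; exact hxw
    change 2 * ‖A x - w‖ + _ < ε
    nlinarith
  refine ⟨T, ⟨hT0, hadd, hcont⟩, fun x y => ⟨fun h => ?_, fun h => ?_⟩⟩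
  · obtain ⟨x', rfl, rfl⟩ := (mem_graph_iff A).1 h
    exact hgen x'
  -- The semigroup's generator is dissipative and extends A, so it cannot be larger: with x' - Ax' =
  -- x - y, the vector v = x - x' is its own derivative at 0. Contractivity then forces ‖v‖² ≤ 0.
  · obtain ⟨x', hx'⟩ := hr1 (x - y)
    have h1 := h.sub (hgen x')
    have h2 : y - A x' = x - x' := by
      rw [← sub_eq_zero, ← sub_eq_zero.2 hx']; abel
    have h3 : ∀ t : ℝ, t⁻¹ • (T t x - x) - t⁻¹ • (T t x' - x') =
        t⁻¹ • (T t (x - x') - (x - x')) := by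
      intro t
      rw [← smul_sub, _root_.map_sub]; congr 1; abel
    simp only [h2, h3] at h1
    have h4 : (inner ℂ (x - x') (x - x' : X)).re ≤ 0 := by
      refine le_of_tendsto ((Complex.continuous_re.tendsto _).comp
        ((tendsto_const_nhds (x := x - (x' : X))).inner (𝕜 := ℂ) h1))
        (eventually_nhdsWithin_of_forall fun t ht => ?_)
      have ht : 0 < t := ht
      have h5 := (Complex.re_le_norm _).trans
        (norm_inner_le_norm (𝕜 := ℂ) (x - x') (T t (x - x')))
      have h6 := mul_le_mul_of_nonneg_left (hT1 t ht.le (x - x')) (norm_nonneg (x - x' : X))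
      simp only [Function.comp_apply]
      rw [← Complex.coe_smul, inner_smul_right, Complex.re_ofReal_mul, inner_sub_right,
        inner_self_eq_norm_sq_to_K]
      refine mul_nonpos_of_nonneg_of_nonpos (inv_nonneg.2 ht.le) ?_
      simp only [Complex.coe_algebraMap, ← Complex.ofReal_pow, Complex.sub_re, Complex.ofReal_re]
      linarith [sq ‖x - (x' : X)‖]
    have h7 : x - x' = 0 := by
      rw [← norm_eq_zero]
      rw [inner_self_eq_norm_sq_to_K] at h4
      have h8 : ‖x - x'‖ ^ 2 ≤ 0 := by simpa [← Complex.ofReal_pow] using h4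
      exact pow_eq_zero_iff two_ne_zero |>.1 (le_antisymm h8 (sq_nonneg _))
    rw [h7, sub_eq_zero] at h2
    rw [sub_eq_zero] at h7
    rw [h2, h7]
    exact mem_graph A x'

end LinearPMap

/-! ### Operators with a scattering Green identity -/

/-- Bipolar theorem for closed operators between Hilbert spaces. -/
theorem LinearPMap.IsClosed.mem_graph_of_forall {X Y : Type*}
    [NormedAddCommGroup X] [InnerProductSpace ℂ X] [CompleteSpace X]
    [NormedAddCommGroup Y] [InnerProductSpace ℂ Y] [CompleteSpace Y] {A : X →ₗ.[ℂ] Y}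
    (hA : A.IsClosed) {v : X} {v' : Y}
    (h : ∀ (y : Y) (y' : X), (∀ x : A.domain, inner ℂ y' (x : X) = inner ℂ y (A x)) →
      inner ℂ v' y = inner ℂ v y') : (v, v') ∈ A.graph := by
  let e : WithLp 2 (X × Y) ≃L[ℂ] X × Y := WithLp.prodContinuousLinearEquiv 2 ℂ X Y
  let Γ : Submodule ℂ (WithLp 2 (X × Y)) := A.graph.comap e.toLinearEquiv.toLinearMap
  have hΓc : _root_.IsClosed (Γ : Set (WithLp 2 (X × Y))) := hA.preimage e.continuous
  have hmem : (WithLp.toLp 2 (v, v') : WithLp 2 (X × Y)) ∈ Γᗮᗮ := by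
    rw [Submodule.mem_orthogonal']
    intro u hu
    have h1 : ∀ x : A.domain, inner ℂ u.fst (x : X) + inner ℂ u.snd (A x) = 0 := by
      intro x
      have h2 := (Submodule.mem_orthogonal' _ _).1 hu (WithLp.toLp 2 ((x : X), A x))
        (A.mem_graph x)
      rwa [WithLp.prod_inner_apply] at h2
    have h3 := h u.snd (-u.fst) fun x => by
      rw [inner_neg_left, neg_eq_iff_add_eq_zero]; exact h1 x
    rw [inner_neg_right] at h3
    rw [WithLp.prod_inner_apply]
    change inner ℂ v u.fst + inner ℂ v' u.snd = 0
    rw [h3, add_neg_cancel]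
  rw [Submodule.orthogonal_orthogonal_eq_closure, hΓc.submodule_topologicalClosure_eq] at hmem
  exact hmem

/-- Joint surjectivity allows testing with (a, 0) and (0, b) separately. In this way a vanishing
Green form yields vanishing boundary values. -/
theorem eq_zero_of_forall_inner_eq {ι W : Type*} [NormedAddCommGroup W] [InnerProductSpace ℂ W]
    {f g : ι → W} (hfg : ∀ a b : W, ∃ z, f z = a ∧ g z = b) {a b : W}
    (hab : ∀ z, inner ℂ (f z) a = inner ℂ (g z) b) : a = 0 ∧ b = 0 := by
  obtain ⟨z, hz, hz'⟩ := hfg a 0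
  obtain ⟨w, hw, hw'⟩ := hfg 0 b
  have h1 := hab z
  have h2 := hab w
  rw [hz, hz', inner_zero_left, inner_self_eq_zero] at h1
  rw [hw, hw', inner_zero_left, eq_comm, inner_self_eq_zero] at h2
  exact ⟨h1, h2⟩

/-- A maximal operator `M` with two boundary maps `Gp`, `Gm` (incoming and outgoing waves) and the
Green identity `⟨M z, w⟩ + ⟨z, M w⟩ = ⟨Gp z, Gp w⟩ - ⟨Gm z, Gm w⟩`. -/
structure IsScatteringTriple {Z W : Type*} [NormedAddCommGroup Z] [InnerProductSpace ℂ Z]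
    [NormedAddCommGroup W] [InnerProductSpace ℂ W]
    (M : Z →ₗ.[ℂ] Z) (Gp Gm : M.domain →ₗ[ℂ] W) : Prop where
  green : ∀ z w : M.domain, inner ℂ (M z) (w : Z) + inner ℂ (z : Z) (M w) =
    inner ℂ (Gp z) (Gp w) - inner ℂ (Gm z) (Gm w)
  surjective : ∀ a b : W, ∃ z, Gp z = a ∧ Gm z = b
  -- Maximality: with M₀ the restriction of M to ker Gp ∩ ker Gm, this says that -M₀* ⊂ M, phrased
  -- without assuming M₀ densely defined.
  mem_graph : ∀ v v' : Z, (∀ z : M.domain, Gp z = 0 → Gm z = 0 →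
    inner ℂ v' (z : Z) + inner ℂ v (M z) = 0) → (v, v') ∈ M.graph

namespace IsScatteringTriple

variable {Z W : Type*} [NormedAddCommGroup Z] [InnerProductSpace ℂ Z]
  [NormedAddCommGroup W] [InnerProductSpace ℂ W]
  {M : Z →ₗ.[ℂ] Z} {Gp Gm : M.domain →ₗ[ℂ] W}

/-- Time reversal exchanges incoming and outgoing waves, so results about ker Gp transfer to ker Gm.
-/
theorem neg (h : IsScatteringTriple M Gp Gm) : IsScatteringTriple (-M) Gm Gp where
  green z w := by
    have h1 := h.green z w
    rw [LinearPMap.neg_apply, LinearPMap.neg_apply, inner_neg_left, inner_neg_right]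
    linear_combination -h1
  surjective a b := (h.surjective b a).imp fun _ hz => ⟨hz.2, hz.1⟩
  mem_graph v v' hv := by
    have h1 := h.mem_graph v (-v') fun z hp hm => by
      have h2 := hv z hm hp
      rw [LinearPMap.neg_apply, inner_neg_right] at h2
      rw [inner_neg_left]
      linear_combination -h2
    obtain ⟨z, hz, hz'⟩ := (LinearPMap.mem_graph_iff M).1 h1
    refine (LinearPMap.mem_graph_iff _).2 ⟨z, hz, ?_⟩
    rw [LinearPMap.neg_apply, hz', neg_neg]

/-- The triple of a closed operator whose adjoint is contained in `-M`. -/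
theorem of_isClosed [CompleteSpace Z] (hc : M.IsClosed)
    (green : ∀ z w : M.domain, inner ℂ (M z) (w : Z) + inner ℂ (z : Z) (M w) =
      inner ℂ (Gp z) (Gp w) - inner ℂ (Gm z) (Gm w))
    (surj : ∀ a b : W, ∃ z, Gp z = a ∧ Gm z = b)
    (hadj : ∀ w w' : Z, (∀ z : M.domain, inner ℂ w' (z : Z) = inner ℂ w (M z)) →
      (w, -w') ∈ M.graph) : IsScatteringTriple M Gp Gm where
  green := green
  surjective := surj
  mem_graph v v' hv := by
    refine hc.mem_graph_of_forall fun w w' hw => ?_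
    obtain ⟨y, rfl, hy⟩ := (LinearPMap.mem_graph_iff M).1 (hadj w w' hw)
    -- Since My = -w', the left side of Green's identity vanishes for every z. Hence y has zero
    -- boundary values and may be used in `hv`.
    have h0 : ∀ z, inner ℂ (Gp z) (Gp y) = inner ℂ (Gm z) (Gm y) := by
      intro z
      rw [← sub_eq_zero, ← green z y, hy, inner_neg_right, ← inner_conj_symm, ← hw z,
        inner_conj_symm, add_neg_cancel]
    obtain ⟨h1, h2⟩ := eq_zero_of_forall_inner_eq surj h0
    have h3 := hv y h1 h2
    rw [hy, inner_neg_right, add_neg_eq_zero] at h3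
    exact h3

theorem isClosed (h : IsScatteringTriple M Gp Gm) : M.IsClosed := by
  have h1 : (M.graph : Set (Z × Z)) = ⋂ (z : M.domain) (_ : Gp z = 0) (_ : Gm z = 0),
      {p : Z × Z | inner ℂ p.2 (z : Z) + inner ℂ p.1 (M z) = 0} := by
    ext ⟨v, v'⟩
    simp only [mem_iInter]
    refine ⟨fun hv z hp hm => ?_, fun hv => h.mem_graph v v' hv⟩
    obtain ⟨x, rfl, rfl⟩ := (LinearPMap.mem_graph_iff M).1 hv
    change inner ℂ (M x) (z : Z) + inner ℂ (x : Z) (M z) = 0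
    rw [h.green, hp, hm, inner_zero_right, inner_zero_right, sub_zero]
  rw [LinearPMap.IsClosed, h1]
  exact isClosed_iInter fun z => isClosed_iInter fun _ => isClosed_iInter fun _ =>
    isClosed_eq (by fun_prop) continuous_const

/-- If v is orthogonal to this kernel, maximality puts (0, v) in the graph of M, so v = 0. -/
theorem dense_ker [CompleteSpace Z] (h : IsScatteringTriple M Gp Gm) :
    Dense (((LinearMap.ker Gp ⊓ LinearMap.ker Gm).map M.domain.subtype : Submodule ℂ Z) :
      Set Z) := by
  rw [Submodule.dense_iff_topologicalClosure_eq_top, Submodule.topologicalClosure_eq_top_iff,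
    Submodule.eq_bot_iff]
  intro v hv
  have h1 := h.mem_graph 0 v fun z hp hm => by
    rw [inner_zero_left, add_zero]
    exact (Submodule.mem_orthogonal' _ _).1 hv z ⟨z, ⟨hp, hm⟩, rfl⟩
  exact M.graph_fst_eq_zero_snd h1 rfl

theorem dense_domain [CompleteSpace Z] (h : IsScatteringTriple M Gp Gm) :
    Dense (M.domain : Set Z) :=
  h.dense_ker.mono (Submodule.map_subtype_le _ _)

/-- By Green's identity M* extends -M₀, where M₀ is M on ker Gp ∩ ker Gm. Hence M** ⊂ -M₀* ⊂ M by
maximality, while M ⊂ M** holds because M* is densely defined. -/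
theorem adjoint_adjoint [CompleteSpace Z] (h : IsScatteringTriple M Gp Gm) :
    M.adjoint.adjoint = M := by
  have hd := h.dense_domain
  have hker : ∀ z : M.domain, Gp z = 0 → Gm z = 0 →
      ∃ hz : (z : Z) ∈ M.adjoint.domain, M.adjoint ⟨z, hz⟩ = -M z := by
    intro z hp hm
    have h1 : ∀ x : M.domain, inner ℂ (-M z) (x : Z) = inner ℂ (z : Z) (M x) := by
      intro x
      have h2 := h.green z x
      rw [hp, hm, inner_zero_left, inner_zero_left, sub_zero] at h2
      rw [inner_neg_left, neg_eq_iff_add_eq_zero]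
      exact h2
    exact ⟨LinearPMap.mem_adjoint_domain_of_exists _ ⟨_, h1⟩,
      LinearPMap.adjoint_apply_eq hd _ h1⟩
  have hd' : Dense (M.adjoint.domain : Set Z) := by
    refine h.dense_ker.mono ?_
    rintro _ ⟨z, ⟨hp, hm⟩, rfl⟩
    exact (hker z hp hm).1
  refine le_antisymm (LinearPMap.le_of_le_graph ?_)
    (LinearPMap.IsFormalAdjoint.le_adjoint hd' (LinearPMap.adjoint_isFormalAdjoint hd))
  rintro ⟨v, v'⟩ hv
  obtain ⟨x, rfl, rfl⟩ := (LinearPMap.mem_graph_iff _).1 hv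
  refine h.mem_graph _ _ fun z hp hm => ?_
  obtain ⟨hz, hz'⟩ := hker z hp hm
  have h1 := LinearPMap.adjoint_isFormalAdjoint hd' x ⟨z, hz⟩
  rw [hz', inner_neg_right] at h1
  rw [h1, neg_add_cancel]

theorem re_inner (h : IsScatteringTriple M Gp Gm) (z : M.domain) :
    2 * (inner ℂ (z : Z) (M z)).re = ‖Gp z‖ ^ 2 - ‖Gm z‖ ^ 2 := by
  have h1 := congrArg Complex.re (h.green z z)
  rw [Complex.add_re, ← inner_conj_symm, Complex.conj_re, inner_self_eq_norm_sq_to_K,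
    inner_self_eq_norm_sq_to_K] at h1
  simp only [Complex.coe_algebraMap, ← Complex.ofReal_pow, Complex.sub_re,
    Complex.ofReal_re] at h1
  linarith

/-- `M` restricted to the kernel of the incoming waves. -/
def mainOperator (M : Z →ₗ.[ℂ] Z) (Gp : M.domain →ₗ[ℂ] W) : Z →ₗ.[ℂ] Z :=
  M.domRestrict ((LinearMap.ker Gp).map M.domain.subtype)

theorem exists_of_mainOperator_domain (x : (mainOperator M Gp).domain) :
    ∃ z : M.domain, Gp z = 0 ∧ (z : Z) = x ∧ mainOperator M Gp x = M z := by
  obtain ⟨x, ⟨z, hz, hzx⟩, hx⟩ := x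
  exact ⟨z, hz, hzx, LinearPMap.domRestrict_apply hzx.symm⟩

theorem exists_mainOperator_eq (z : M.domain) (hz : Gp z = 0) :
    ∃ x : (mainOperator M Gp).domain, (x : Z) = z ∧ mainOperator M Gp x = M z :=
  ⟨⟨z, ⟨z, hz, rfl⟩, z.2⟩, rfl, LinearPMap.domRestrict_apply rfl⟩

theorem isDissipative (h : IsScatteringTriple M Gp Gm) : (mainOperator M Gp).IsDissipative := by
  intro x
  obtain ⟨z, hz, hzx, hMz⟩ := exists_of_mainOperator_domain x
  have h1 := h.re_inner z
  rw [hz, norm_zero] at h1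
  rw [hMz, ← hzx]
  nlinarith [sq_nonneg ‖Gm z‖]

/-- Inside the closed graph of M, the condition Gp z = 0 amounts to the Green form of z vanishing
against all w with Gm w = 0: take Gp w = Gp z. These conditions are closed, so continuity of Gp is
not needed. -/
theorem mainOperator_isClosed (h : IsScatteringTriple M Gp Gm) :
    (mainOperator M Gp).IsClosed := by
  have h1 : ((mainOperator M Gp).graph : Set (Z × Z)) = (M.graph : Set (Z × Z)) ∩
      ⋂ (w : M.domain) (_ : Gm w = 0),
        {p : Z × Z | inner ℂ p.2 (w : Z) + inner ℂ p.1 (M w) = 0} := by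
    ext ⟨v, v'⟩
    simp only [mem_inter_iff, mem_iInter]
    constructor
    · intro hv
      obtain ⟨x, rfl, rfl⟩ := (LinearPMap.mem_graph_iff _).1 hv
      obtain ⟨z, hz, hzx, hMz⟩ := exists_of_mainOperator_domain x
      rw [← hzx, hMz]
      refine ⟨M.mem_graph z, fun w hw => ?_⟩
      change inner ℂ (M z) (w : Z) + inner ℂ (z : Z) (M w) = 0
      rw [h.green, hz, hw, inner_zero_right, inner_zero_left, sub_zero]
    · rintro ⟨hv, hv'⟩
      obtain ⟨z, rfl, rfl⟩ := (LinearPMap.mem_graph_iff _).1 hv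
      obtain ⟨w, hw, hw'⟩ := h.surjective (Gp z) 0
      have h2 : inner ℂ (M z) (w : Z) + inner ℂ (z : Z) (M w) = 0 := hv' w hw'
      rw [h.green, hw, hw', inner_zero_right, sub_zero, inner_self_eq_zero] at h2
      obtain ⟨x, hx, hx'⟩ := exists_mainOperator_eq z h2
      change ((z : Z), M z) ∈ (mainOperator M Gp).graph
      rw [← hx, ← hx']
      exact LinearPMap.mem_graph _ x
  rw [LinearPMap.IsClosed, h1]
  exact h.isClosed.inter (isClosed_iInter fun w => isClosed_iInter fun _ =>
    isClosed_eq (by fun_prop) continuous_const)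

/-- The main operator is maximal dissipative. -/
theorem exists_smul_sub [CompleteSpace Z] (h : IsScatteringTriple M Gp Gm) {l : ℝ} (hl : 0 < l)
    (y : Z) : ∃ x : (mainOperator M Gp).domain, (l : ℂ) • (x : Z) - mainOperator M Gp x = y := by
  set L := mainOperator M Gp
  let V : L.domain →ₗ[ℂ] Z := (l : ℂ) • L.domain.subtype - L.toFun
  have hV : ∀ x, V x = (l : ℂ) • (x : Z) - L x := fun _ => rfl
  -- The dissipative estimate bounds preimages by images, so a convergent sequence in the range has
  -- Cauchy preimages; closedness of L finishes.
  have hcl : IsClosed (LinearMap.range V : Set Z) := by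
    refine IsSeqClosed.isClosed fun u p hu hup => ?_
    choose x hx using fun n => LinearMap.mem_range.1 (hu n)
    have hcx : CauchySeq fun n => (x n : Z) := by
      rw [cauchySeq_iff_tendsto_dist_atTop_0]
      have h1 := (cauchySeq_iff_tendsto_dist_atTop_0.1 hup.cauchySeq).const_mul l⁻¹
      rw [mul_zero] at h1
      refine squeeze_zero (fun _ => dist_nonneg) (fun n => ?_) h1
      have h2 := h.isDissipative.norm_le hl (x n.1 - x n.2)
      rw [← hV, map_sub, hx, hx] at h2
      rw [dist_eq_norm, dist_eq_norm]
      exact h2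
    obtain ⟨q, hq⟩ := cauchySeq_tendsto_of_complete hcx
    have h1 : Tendsto (fun n => L (x n)) atTop (𝓝 ((l : ℂ) • q - p)) := by
      refine ((hq.const_smul (l : ℂ)).sub hup).congr fun n => ?_
      rw [← hx n, hV, sub_sub_cancel]
    have h2 : (q, (l : ℂ) • q - p) ∈ L.graph :=
      h.mainOperator_isClosed.mem_of_tendsto (hq.prodMk_nhds h1)
        (Eventually.of_forall fun n => L.mem_graph (x n))
    obtain ⟨x', hx', hx''⟩ := (LinearPMap.mem_graph_iff _).1 h2
    refine ⟨x', ?_⟩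
    simp only at hx' hx''
    rw [hV, hx', hx'', sub_sub_cancel]
  have htop : LinearMap.range V = ⊤ := by
    rw [← hcl.submodule_topologicalClosure_eq, Submodule.topologicalClosure_eq_top_iff,
      Submodule.eq_bot_iff]
    intro v hv
    have h0 : ∀ z : M.domain, Gp z = 0 →
        inner ℂ ((-l : ℂ) • v) (z : Z) + inner ℂ v (M z) = 0 := by
      intro z hz
      obtain ⟨x, hx, hx'⟩ := exists_mainOperator_eq z hz
      have h1 := (Submodule.mem_orthogonal' _ _).1 hv (V x) ⟨x, rfl⟩
      rw [hV, hx, hx', inner_sub_right, inner_smul_right] at h1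
      rw [inner_smul_left, map_neg, Complex.conj_ofReal]
      linear_combination -h1
    obtain ⟨w, rfl, hw⟩ := (LinearPMap.mem_graph_iff _).1
      (h.mem_graph v ((-l : ℂ) • v) fun z hp _ => h0 z hp)
    simp only at hw
    -- Here w is orthogonal to the range and Mw = -lw. Green's identity against z gives Gm w = 0,
    -- and the power balance then gives -2l‖w‖² = ‖Gp w‖², so w = 0.
    obtain ⟨z, hz, hz'⟩ := h.surjective 0 (Gm w)
    have h1 := h0 z hz
    rw [← hw, h.green, hz, hz', inner_zero_right, zero_sub, neg_eq_zero,
      inner_self_eq_zero] at h1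
    have h2 := h.re_inner w
    rw [h1, norm_zero, hw, inner_smul_right, inner_self_eq_norm_sq_to_K] at h2
    simp only [Complex.coe_algebraMap, ← Complex.ofReal_pow, ← Complex.ofReal_neg,
      ← Complex.ofReal_mul, Complex.ofReal_re] at h2
    rw [← norm_eq_zero]
    refine pow_eq_zero_iff two_ne_zero |>.1 (le_antisymm ?_ (sq_nonneg _))
    nlinarith [sq_nonneg ‖Gp w‖, sq_nonneg ‖(w : Z)‖]
  obtain ⟨x, hx⟩ : y ∈ LinearMap.range V := htop ▸ Submodule.mem_top
  exact ⟨x, hx⟩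

/-- Exponentially decaying eigenvectors with arbitrary outgoing wave. -/
theorem exists_eigenvector [CompleteSpace Z] (h : IsScatteringTriple M Gp Gm) (b : W) :
    ∃ z : M.domain, M z = -(z : Z) ∧ Gm z = b := by
  obtain ⟨z, -, hz⟩ := h.surjective 0 b
  -- Correct z by a w in ker Gm with (1 + M)w = (1 + M)z; then z - w keeps the outgoing wave b.
  obtain ⟨x, hx⟩ := h.neg.exists_smul_sub one_pos ((z : Z) + M z)
  obtain ⟨w, hw, hwx, hMw⟩ := exists_of_mainOperator_domain x
  rw [← hwx, hMw, LinearPMap.neg_apply, Complex.ofReal_one, one_smul, sub_neg_eq_add] at hx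
  refine ⟨z - (w : M.domain), ?_, ?_⟩
  · rw [LinearPMap.map_sub, Submodule.coe_sub, eq_neg_iff_add_eq_zero]
    change M z - M w + ((z : Z) - w) = 0
    rw [← sub_eq_zero] at hx
    rw [← neg_eq_zero, ← hx]; abel
  · rw [map_sub, hw, hz, sub_zero]

theorem generatesC0Semigroup [CompleteSpace Z] (h : IsScatteringTriple M Gp Gm) :
    (mainOperator M Gp).GeneratesC0Semigroup :=
  h.isDissipative.generatesC0Semigroup fun _ hl => h.exists_smul_sub hl

end IsScatteringTriple

/-! ### Scattering nodes: well-posedness, power balance, passivity -/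

namespace IsScatteringTriple

variable {Z W : Type*} [NormedAddCommGroup Z] [InnerProductSpace ℂ Z]
  [NormedAddCommGroup W] [InnerProductSpace ℂ W]
  {M : Z →ₗ.[ℂ] Z} {Gp Gm : M.domain →ₗ[ℂ] W}

/-- The boundary maps are continuous with respect to the graph norm. -/
theorem exists_continuous_boundary [CompleteSpace Z] [CompleteSpace W]
    (h : IsScatteringTriple M Gp Gm) :
    ∃ Φ : M.graph →L[ℂ] W × W, ∀ z : M.domain,
      Φ ⟨((z : Z), M z), M.mem_graph z⟩ = (Gp z, Gm z) := by
  have : CompleteSpace M.graph := IsClosed.completeSpace_coe (hs := h.isClosed)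
  let e : M.graph →ₗ[ℂ] M.domain := LinearMap.codRestrict M.domain
    (LinearMap.fst ℂ Z Z ∘ₗ M.graph.subtype) fun p => M.mem_domain_of_mem_graph p.2
  have he' : ∀ p : M.graph, p.1.2 = M (e p) := by
    rintro ⟨⟨p, p'⟩, hp⟩
    obtain ⟨z, rfl, rfl⟩ := (LinearPMap.mem_graph_iff M).1 hp
    rfl
  let V : M.graph →ₗ[ℂ] W × W := Gp.prod Gm ∘ₗ e
  have hcl : IsClosed (V.graph : Set (M.graph × W × W)) := by
    -- Green's identity against all w determines the boundary values uniquely, so it presents the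
    -- graph of V as an intersection of closed sets.
    have h1 : (V.graph : Set (M.graph × W × W)) = ⋂ w : M.domain,
        {q | inner ℂ (M w) q.1.1.1 + inner ℂ (w : Z) q.1.1.2 =
          inner ℂ (Gp w) q.2.1 - inner ℂ (Gm w) q.2.2} := by
      ext ⟨p, a, b⟩
      simp only [mem_iInter, mem_ofPred_eq, SetLike.mem_coe, LinearMap.mem_graph_iff, he']
      change (a, b) = (Gp (e p), Gm (e p)) ↔
        ∀ w : M.domain, inner ℂ (M w) (e p : Z) + inner ℂ (w : Z) (M (e p)) = _
      simp only [h.green]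
      refine ⟨fun hab w => ?_, fun hab => ?_⟩
      · rw [Prod.mk.injEq] at hab
        rw [hab.1, hab.2]
      · obtain ⟨h2, h3⟩ := eq_zero_of_forall_inner_eq h.surjective
          (a := a - Gp (e p)) (b := b - Gm (e p)) fun w => by
            rw [inner_sub_right, inner_sub_right]
            linear_combination -(hab w)
        rw [sub_eq_zero.1 h2, sub_eq_zero.1 h3]
    rw [h1]
    exact isClosed_iInter fun w => isClosed_eq (by fun_prop) (by fun_prop)
  exact ⟨⟨V, V.continuous_of_isClosed_graph hcl⟩, fun _ => rfl⟩

/-- The scattering colligation with output `-P Gm`. -/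
def node (Gp Gm : M.domain →ₗ[ℂ] W) (P : W →L[ℂ] W) : Colligation W Z W where
  dom := M.domain
  G := Gp
  L := M.toFun
  K := -(P.toLinearMap ∘ₗ Gm)

theorem node_combined_isClosed [CompleteSpace Z] [CompleteSpace W]
    (h : IsScatteringTriple M Gp Gm) (P : W →L[ℂ] W) : (node Gp Gm P).combined.IsClosed := by
  obtain ⟨Φ, hΦ⟩ := h.exists_continuous_boundary
  refine IsSeqClosed.isClosed fun u p hu hup => ?_
  choose x hx hx' using fun n => (LinearPMap.mem_graph_iff _).1 (hu n)
  have hx'' : ∀ n, (u n).2 = (Gp (x n), M (x n), -P (Gm (x n))) := fun n => (hx' n).symm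
  have h1 : Tendsto (fun n => (x n : Z)) atTop (𝓝 p.1) :=
    ((continuous_fst.tendsto _).comp hup).congr fun n => (hx n).symm
  have h2 : Tendsto (fun n => (u n).2) atTop (𝓝 p.2) := (continuous_snd.tendsto _).comp hup
  simp only [hx''] at h2
  have h3 : Tendsto (fun n => M (x n)) atTop (𝓝 p.2.2.1) :=
    ((continuous_fst.comp continuous_snd).tendsto _).comp h2
  have h4 : (p.1, p.2.2.1) ∈ M.graph := h.isClosed.mem_of_tendsto (h1.prodMk_nhds h3)
    (Eventually.of_forall fun n => M.mem_graph (x n))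
  obtain ⟨z, hz, hz'⟩ := (LinearPMap.mem_graph_iff _).1 h4
  simp only at hz hz'
  have h5 : Tendsto (fun n => (Gp (x n), Gm (x n))) atTop (𝓝 (Gp z, Gm z)) := by
    have h6 : Tendsto (fun n => (⟨_, M.mem_graph (x n)⟩ : M.graph)) atTop
        (𝓝 ⟨_, M.mem_graph z⟩) := by
      rw [tendsto_subtype_rng]
      simp only [hz, hz']
      exact h1.prodMk_nhds h3
    have h7 := (Φ.continuous.tendsto _).comp h6
    rw [hΦ] at h7
    exact h7.congr fun n => hΦ (x n)
  have h6 : Tendsto (fun n => (Gp (x n), M (x n), -P (Gm (x n)))) atTop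
      (𝓝 (Gp z, M z, -P (Gm z))) := by
    have h7 : Tendsto (fun n => Gm (x n)) atTop (𝓝 (Gm z)) := (continuous_snd.tendsto _).comp h5
    exact ((continuous_fst.tendsto _).comp h5).prodMk_nhds
      ((hz' ▸ h3).prodMk_nhds ((P.continuous.tendsto _).comp h7).neg)
  exact (LinearPMap.mem_graph_iff _).2 ⟨z, hz, (tendsto_nhds_unique h2 h6).symm⟩

/-- P enters only through the closedness of the combined operator; the main operator does not
involve it. -/
theorem node_isInternallyWellPosed [CompleteSpace Z] [CompleteSpace W]
    (h : IsScatteringTriple M Gp Gm) (P : W →L[ℂ] W) :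
    (node Gp Gm P).IsInternallyWellPosed := by
  refine ⟨⟨h.node_combined_isClosed P, fun a => (h.surjective a 0).imp fun _ hz => hz.1, ?_, ?_⟩,
    h.generatesC0Semigroup⟩
  · exact h.dense_ker.mono (Submodule.map_mono inf_le_left)
  · obtain ⟨R, h1, h2, -⟩ := h.isDissipative.exists_resolvent one_pos (h.exists_smul_sub one_pos)
    exact ⟨((1 : ℝ) : ℂ), R, h1, h2⟩

/-- The power balance of a smooth solution. -/
theorem node_power_balance (h : IsScatteringTriple M Gp Gm) {P : W →L[ℂ] W}
    {u : ℝ → W} {z : ℝ → (node Gp Gm P).dom} {y : ℝ → W}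
    (hs : (node Gp Gm P).IsSmoothSolution u z y) {t : ℝ} (ht : 0 ≤ t) :
    derivWithin (fun s => ‖(z s : Z)‖ ^ 2) (Ici 0) t + ‖y t‖ ^ 2 =
      ‖u t‖ ^ 2 - (‖Gm (z t)‖ ^ 2 - ‖P (Gm (z t))‖ ^ 2) := by
  have h1 : HasDerivWithinAt (fun s => (z s : Z)) (M (z t)) (Ici 0) t := hs.state_eq t ht
  have h2 := Complex.reCLM.hasFDerivAt.comp_hasDerivWithinAt t (h1.inner ℂ h1)
  have h3 : (⇑Complex.reCLM ∘ fun s => inner ℂ (z s : Z) (z s : Z)) =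
      fun s => ‖(z s : Z)‖ ^ 2 := by
    ext s
    simp [inner_self_eq_norm_sq_to_K, ← Complex.ofReal_pow]
  rw [h3] at h2
  have h4 : (inner ℂ (z t : Z) (M (z t)) + inner ℂ (M (z t)) (z t : Z)).re =
      ‖Gp (z t)‖ ^ 2 - ‖Gm (z t)‖ ^ 2 := by
    have h5 := h.re_inner (z t)
    rw [Complex.add_re, ← inner_conj_symm (M (z t)), Complex.conj_re, ← h5]
    ring
  have h6 : ‖y t‖ = ‖P (Gm (z t))‖ := by
    rw [hs.output_eq t ht]
    exact norm_neg _
  have h7 : ‖u t‖ = ‖Gp (z t)‖ := congrArg norm (hs.input_eq t ht)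
  rw [h2.derivWithin (uniqueDiffOn_Ici 0 t ht), Complex.reCLM_apply, h4, h6, h7]
  ring

/-- An eigenvector for the eigenvalue `-1` is the initial value of a smooth solution. -/
theorem node_isSmoothSolution_of_eigenvector (P : W →L[ℂ] W) {z : M.domain}
    (hz : M z = -(z : Z)) :
    (node Gp Gm P).IsSmoothSolution (fun t => ((Real.exp (-t) : ℝ) : ℂ) • Gp z)
      (fun t => (((Real.exp (-t) : ℝ) : ℂ) • z : M.domain))
      (fun t => ((Real.exp (-t) : ℝ) : ℂ) • -P (Gm z)) := by
  have hc : ∀ {n : WithTop ℕ∞}, ContDiff ℝ n fun t : ℝ => ((Real.exp (-t) : ℝ) : ℂ) :=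
    Complex.ofRealCLM.contDiff.comp (Real.contDiff_exp.comp contDiff_neg)
  have hcc : Continuous fun t : ℝ => ((Real.exp (-t) : ℝ) : ℂ) := by fun_prop
  refine ⟨(hc.smul contDiff_const).contDiffOn, (hc.smul contDiff_const).contDiffOn, ?_,
    fun t _ => (map_smul Gp _ _).symm, fun t _ => ?_,
    fun t _ => ((node Gp Gm P).K.map_smul _ z).symm⟩
  · have h1 : Continuous fun t : ℝ => ((Real.exp (-t) : ℝ) : ℂ) •
        ((z : Z), Gp z, M z, -P (Gm z)) := hcc.smul continuous_const
    refine h1.continuousOn.congr fun t _ => ?_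
    refine Prod.ext rfl (Prod.ext (map_smul Gp _ _) (Prod.ext (M.map_smul _ _) ?_))
    exact (node Gp Gm P).K.map_smul _ z
  · have h1 : HasDerivAt (fun s : ℝ => ((Real.exp (-s) : ℝ) : ℂ))
        ((Real.exp (-t) * -1 : ℝ) : ℂ) t :=
      ((Real.hasDerivAt_exp _).comp t (hasDerivAt_neg t)).ofReal_comp
    have h2 := (h1.smul_const (z : Z)).hasDerivWithinAt (s := Ici 0)
    refine h2.congr_deriv ?_
    change _ = M (((Real.exp (-t) : ℝ) : ℂ) • z)
    rw [M.map_smul, hz]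
    simp

/-- Every vector is the outgoing wave at time `0` of some smooth solution. -/
theorem exists_node_isSmoothSolution [CompleteSpace Z] (h : IsScatteringTriple M Gp Gm)
    (P : W →L[ℂ] W) (g : W) :
    ∃ u, ∃ z : ℝ → (node Gp Gm P).dom, ∃ y, (node Gp Gm P).IsSmoothSolution u z y ∧
      Gm (z 0) = g := by
  obtain ⟨z, hz, hg⟩ := h.exists_eigenvector g
  refine ⟨_, _, _, node_isSmoothSolution_of_eigenvector P hz, ?_⟩
  rw [neg_zero, Real.exp_zero, Complex.ofReal_one, one_smul, hg]

/-- The defect in the power balance is ‖g‖² - ‖Pg‖² with g = Gm z(t), and every g occurs at time 0.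
-/
theorem node_isScatteringPassive_iff [CompleteSpace Z] [CompleteSpace W]
    (h : IsScatteringTriple M Gp Gm) (P : W →L[ℂ] W) :
    (node Gp Gm P).IsScatteringPassive ↔ ‖P‖ ≤ 1 := by
  refine ⟨fun hp => P.opNorm_le_bound zero_le_one fun g => ?_, fun hP =>
    ⟨h.node_isInternallyWellPosed P, fun u z y hs t ht => ?_⟩⟩
  · obtain ⟨u, z, y, hs, hg⟩ := h.exists_node_isSmoothSolution P g
    have h1 := hp.2 _ _ _ hs 0 le_rfl
    rw [h.node_power_balance hs le_rfl, hg] at h1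
    rw [one_mul]
    exact le_of_sq_le_sq (by linarith) (norm_nonneg g)
  · rw [h.node_power_balance hs ht]
    have h2 : ‖P (Gm (z t))‖ ≤ ‖Gm (z t)‖ := by simpa using P.le_of_opNorm_le hP (Gm (z t))
    have h3 := pow_le_pow_left₀ (norm_nonneg _) h2 2
    linarith

theorem node_isScatteringEnergyPreserving_iff [CompleteSpace Z] [CompleteSpace W]
    (h : IsScatteringTriple M Gp Gm) (P : W →L[ℂ] W) :
    (node Gp Gm P).IsScatteringEnergyPreserving ↔ ∀ g, ‖P g‖ = ‖g‖ := by
  refine ⟨fun hp g => ?_, fun hP =>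
    ⟨h.node_isInternallyWellPosed P, fun u z y hs t ht => ?_⟩⟩
  · obtain ⟨u, z, y, hs, hg⟩ := h.exists_node_isSmoothSolution P g
    have h1 := hp.2 _ _ _ hs 0 le_rfl
    rw [h.node_power_balance hs le_rfl, hg] at h1
    refine (sq_eq_sq₀ (norm_nonneg _) (norm_nonneg _)).1 ?_
    linarith
  · rw [h.node_power_balance hs ht, hP, sub_self, sub_zero]

end IsScatteringTriple

/-! ### Second order systems -/

theorem inner_rieszIso_left {E : Type*} [NormedAddCommGroup E] [InnerProductSpace ℂ E]
    [CompleteSpace E] (x : E) (f : AntiDual E) : inner ℂ (rieszIso E x) f = f x := by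
  change inner ℂ ((rieszIso E).symm (rieszIso E x)) ((rieszIso E).symm f) = f x
  rw [LinearIsometryEquiv.symm_apply_apply, ← rieszIso_apply,
    LinearIsometryEquiv.apply_symm_apply]

theorem inner_rieszIso_right {E : Type*} [NormedAddCommGroup E] [InnerProductSpace ℂ E]
    [CompleteSpace E] (x : E) (f : AntiDual E) : inner ℂ f (rieszIso E x) = conj (f x) :=
  (inner_conj_symm (𝕜 := ℂ) f (rieszIso E x)).symm.trans (congrArg conj (inner_rieszIso_left x f))

/-- The polarization identity behind the scattering transform. -/
theorem inner_smul_add_sub_inner_smul_sub {W : Type*} [NormedAddCommGroup W]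
    [InnerProductSpace ℂ W] {c : ℂ} (hc : c * c = 1 / 2) (hc' : conj c = c) (a b a' b' : W) :
    inner ℂ (c • (a + b)) (c • (a' + b')) - inner ℂ (c • (a - b)) (c • (a' - b')) =
      inner ℂ a b' + inner ℂ b a' := by
  simp only [inner_smul_left, inner_smul_right, inner_add_left, inner_add_right,
    inner_sub_left, inner_sub_right, hc']
  linear_combination (2 * (inner ℂ a b' + inner ℂ b a')) * hc

theorem smul_smul_add_add_smul_sub {W : Type*} [AddCommGroup W] [Module ℂ W] {c : ℂ}
    (hc : c * c = 1 / 2) (a b : W) : c • (c • (a + b) + c • (a - b)) = a := by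
  rw [← smul_add, smul_smul, hc, add_add_sub_cancel, ← two_smul ℂ a, smul_smul]
  norm_num

theorem smul_smul_add_sub_smul_sub {W : Type*} [AddCommGroup W] [Module ℂ W] {c : ℂ}
    (hc : c * c = 1 / 2) (a b : W) : c • (c • (a + b) - c • (a - b)) = b := by
  rw [← smul_sub, smul_smul, hc, add_sub_sub_cancel, ← two_smul ℂ b, smul_smul]
  norm_num

theorem exists_antiDualProd_eq {E F : Type*} [NormedAddCommGroup E] [InnerProductSpace ℂ E]
    [NormedAddCommGroup F] [InnerProductSpace ℂ F] (f : AntiDual (WithLp 2 (E × F))) :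
    ∃ a b, antiDualProd (a, b) = f := by
  refine ⟨f.comp ((WithLp.prodContinuousLinearEquiv 2 ℂ E F).symm.toContinuousLinearMap.comp
      (ContinuousLinearMap.inl ℂ E F)),
    f.comp ((WithLp.prodContinuousLinearEquiv 2 ℂ E F).symm.toContinuousLinearMap.comp
      (ContinuousLinearMap.inr ℂ E F)), ?_⟩
  ext x
  rw [antiDualProd_apply]
  change f (WithLp.toLp 2 (x.fst, 0)) + f (WithLp.toLp 2 (0, x.snd)) = f x
  rw [← map_add, ← WithLp.toLp_add, Prod.mk_add_mk, add_zero, zero_add]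
  rfl

namespace SecondOrderSystem

variable {X Y : Type*} [NormedAddCommGroup X] [InnerProductSpace ℂ X] [CompleteSpace X]
  [NormedAddCommGroup Y] [InnerProductSpace ℂ Y] [CompleteSpace Y] (D : SecondOrderSystem X Y)

/-- The operator A is isometric on the complete energy space, so its range is closed and y can be
projected onto it. The remainder k lies in ker A*, hence in ker B. -/
theorem exists_energyA_add (y : Y) :
    ∃ z : D.EnergySpace, ∃ k : Y, y = D.energyA z + k ∧ ∀ x, inner ℂ k (D.energyA x) = 0 := by
  let R : Submodule ℂ Y := LinearMap.range D.energyA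
  have hiso : Isometry D.energyA := AddMonoidHomClass.isometry_of_norm _ fun _ => rfl
  have : CompleteSpace R := by
    have h1 : IsComplete (Set.range D.energyA) := hiso.isUniformInducing.isComplete_range
    exact completeSpace_coe_iff_isComplete.2 h1
  obtain ⟨z, hz⟩ : R.starProjection y ∈ R := Submodule.starProjection_apply_mem _ _
  exact ⟨z, y - D.energyA z, by abel, fun x => by
    rw [hz]; exact Submodule.starProjection_inner_eq_zero y _ ⟨x, rfl⟩⟩

theorem mem_B_graph {y : Y} {y' : X}
    (h : ∀ x : D.A.domain, inner ℂ y' (x : X) = inner ℂ y (D.A x)) : (y, -y') ∈ D.B.graph := by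
  have h1 : y ∈ D.A.adjoint.domain := LinearPMap.mem_adjoint_domain_of_exists _ ⟨y', h⟩
  have h2 : D.A.adjoint ⟨y, h1⟩ = y' := LinearPMap.adjoint_apply_eq D.A_dense _ h
  have h3 : (y, y') ∈ (-D.B).graph := LinearPMap.le_graph_of_le D.dualPair
    (h2 ▸ LinearPMap.mem_graph _ ⟨y, h1⟩)
  obtain ⟨b, rfl, hb⟩ := (LinearPMap.mem_graph_iff _).1 h3
  rw [LinearPMap.neg_apply, neg_eq_iff_eq_neg] at hb
  exact (LinearPMap.mem_graph_iff _).2 ⟨b, rfl, hb⟩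

/-- This decouples the maximal operator into one condition on A and one on B, which can be treated
separately. Injectivity of A recovers the first component of w from its image. -/
theorem mem_maxOperator_graph {z w : D.StateSpace} :
    (z, w) ∈ D.maxOperator.graph ↔
      (z.snd, D.energyA w.fst) ∈ D.A.graph ∧ (D.energyA z.fst, w.snd) ∈ D.B.graph := by
  constructor
  · intro h
    obtain ⟨z, rfl, rfl⟩ := (LinearPMap.mem_graph_iff _).1 h
    exact ⟨D.A.mem_graph (D.velocity z), D.B.mem_graph (D.strain z)⟩
  · rintro ⟨h1, h2⟩
    obtain ⟨x, hx, hx'⟩ := (LinearPMap.mem_graph_iff _).1 h1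
    obtain ⟨y, hy, hy'⟩ := (LinearPMap.mem_graph_iff _).1 h2
    simp only at hx hx' hy hy'
    have hz : z ∈ D.maxDomain := by
      refine ⟨?_, ?_⟩
      · change D.energyA z.fst ∈ D.B.domain
        rw [← hy]; exact y.2
      · change z.snd ∈ D.A.domain
        rw [← hx]; exact x.2
    have hv : D.velocity ⟨z, hz⟩ = x := Subtype.ext hx.symm
    have hs : D.strain ⟨z, hz⟩ = y := Subtype.ext hy.symm
    have hw : D.toDom.symm x = w.fst := D.energyA_injective hx'
    rw [LinearPMap.mem_graph_iff]
    refine ⟨⟨z, hz⟩, rfl, ?_⟩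
    change WithLp.toLp 2 (D.toDom.symm (D.velocity ⟨z, hz⟩), D.B (D.strain ⟨z, hz⟩)) = w
    rw [hv, hs, hw, hy']
    rfl

theorem maxOperator_isClosed : D.maxOperator.IsClosed := by
  have hA : Continuous D.energyA :=
    (AddMonoidHomClass.isometry_of_norm D.energyA fun _ => rfl).continuous
  have hfst : Continuous fun z : D.StateSpace => z.fst := (WithLp.fstL 2 ℂ _ _).continuous
  have hsnd : Continuous fun z : D.StateSpace => z.snd := (WithLp.sndL 2 ℂ _ _).continuous
  have h1 : (D.maxOperator.graph : Set (D.StateSpace × D.StateSpace)) =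
      (fun p => (p.1.snd, D.energyA p.2.fst)) ⁻¹' (D.A.graph : Set (X × Y)) ∩
        (fun p => (D.energyA p.1.fst, p.2.snd)) ⁻¹' (D.B.graph : Set (Y × X)) := by
    ext ⟨z, w⟩
    exact D.mem_maxOperator_graph
  rw [LinearPMap.IsClosed, h1]
  exact (D.A_closed.preimage (by fun_prop)).inter (D.B_closed.preimage (by fun_prop))

/-- The adjoint of the maximal operator is contained in its negative. -/
theorem mem_maxOperator_graph_of_adjoint {w w' : D.StateSpace}
    (h : ∀ z : D.maxOperator.domain, inner ℂ w' (z : D.StateSpace) = inner ℂ w (D.maxOperator z)) :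
    (w, -w') ∈ D.maxOperator.graph := by
  have h' : ∀ (p₁ : D.EnergySpace) (p₂ : X) (q₁ : D.EnergySpace) (q₂ : X),
      (p₂, D.energyA q₁) ∈ D.A.graph → (D.energyA p₁, q₂) ∈ D.B.graph →
      inner ℂ w'.fst p₁ + inner ℂ w'.snd p₂ = inner ℂ w.fst q₁ + inner ℂ w.snd q₂ := by
    intro p₁ p₂ q₁ q₂ hA hB
    obtain ⟨z, hz, hz'⟩ := (LinearPMap.mem_graph_iff _).1
      ((D.mem_maxOperator_graph (z := WithLp.toLp 2 (p₁, p₂)) (w := WithLp.toLp 2 (q₁, q₂))).2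
        ⟨hA, hB⟩)
    have h1 := h z
    rw [hz, hz', WithLp.prod_inner_apply, WithLp.prod_inner_apply] at h1
    exact h1
  rw [mem_maxOperator_graph]
  constructor
  · refine D.A_closed.mem_graph_of_forall fun y y' hy => ?_
    -- The hypothesis can be tested only with elements of ran A in the first slot. Dropping k is
    -- harmless, since it lies in ker B and is orthogonal to ran A.
    obtain ⟨z, k, rfl, hk⟩ := D.exists_energyA_add y
    have h1 := D.mem_B_graph hy
    have h2 : (k, (-0 : X)) ∈ D.B.graph := D.mem_B_graph fun x => by
      rw [inner_zero_left]; exact (hk (D.toDom.symm x)).symm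
    have h3 : (D.energyA z, -y') ∈ D.B.graph := by
      have h4 := D.B.graph.sub_mem h1 h2
      rwa [Prod.mk_sub_mk, add_sub_cancel_right, neg_zero, sub_zero] at h4
    have h4 := h' z 0 0 (-y') (by rw [map_zero]; exact D.A.graph.zero_mem) h3
    rw [inner_zero_right, inner_zero_right, add_zero, zero_add, inner_neg_right] at h4
    have h5 : inner ℂ (D.energyA w'.fst) k = 0 := by
      rw [← inner_conj_symm, hk, map_zero]
    have h6 : inner ℂ (D.energyA w'.fst) (D.energyA z) = -inner ℂ w.snd y' := h4
    change inner ℂ (D.energyA (-w'.fst)) (D.energyA z + k) = _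
    rw [map_neg, inner_neg_left, inner_add_right, h5, h6, add_zero, neg_neg]
  · refine D.mem_B_graph fun x => ?_
    have h1 := h' 0 x (D.toDom.symm x) 0 (D.A.mem_graph x)
      (by rw [map_zero]; exact D.B.graph.zero_mem)
    rw [inner_zero_right, inner_zero_right, add_zero, zero_add] at h1
    exact h1

/-! ### The scattering triple of a boundary triplet -/

namespace BoundaryTriplet

variable {D} {G₁ G₂ : Type*}
  [NormedAddCommGroup G₁] [InnerProductSpace ℂ G₁]
  [NormedAddCommGroup G₂] [InnerProductSpace ℂ G₂]

theorem Γ₁_apply_Γ₀ (T : D.BoundaryTriplet G₁ G₂) (z w : D.maxDomain) :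
    T.Γ₁ w (T.Γ₀ z) = -T.Pi₁ (D.strain w) (T.Λ₁ (D.velocity z)) +
      T.Λ₂ (D.velocity w) (T.Pi₂ (D.strain z)) := rfl

theorem inner_maxOperator (T : D.BoundaryTriplet G₁ G₂) (z w : D.maxDomain) :
    inner ℂ (D.maxOperator z) (w : D.StateSpace) + inner ℂ (z : D.StateSpace) (D.maxOperator w) =
      T.Γ₁ w (T.Γ₀ z) + conj (T.Γ₁ z (T.Γ₀ w)) := by
  rw [WithLp.prod_inner_apply, WithLp.prod_inner_apply, Γ₁_apply_Γ₀, Γ₁_apply_Γ₀]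
  have h1 := T.green (D.strain w) (D.velocity z)
  have h2 := congrArg conj (T.green (D.strain z) (D.velocity w))
  simp only [map_sub, map_neg, map_add, inner_conj_symm, Complex.conj_conj] at h1 h2 ⊢
  change inner ℂ (D.A (D.velocity z)) (D.strain w : Y) +
    inner ℂ (D.B (D.strain z)) (D.velocity w : X)
    + (inner ℂ (D.strain z : Y) (D.A (D.velocity w)) +
      inner ℂ (D.velocity z : X) (D.B (D.strain w))) = _
  linear_combination -h1 - h2

variable [CompleteSpace G₂]

/-- For such k the left side of Green's formula vanishes for every x, and surjectivity of Λ
separates the two pairings. Thus subtracting k from an element of dom B leaves Π unchanged. -/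
theorem Pi_eq_zero (T : D.BoundaryTriplet G₁ G₂) {k : D.B.domain} (hB : D.B k = 0)
    (hk : ∀ x : D.A.domain, inner ℂ (D.A x) (k : Y) = 0) : T.Pi₁ k = 0 ∧ T.Pi₂ k = 0 := by
  have h1 : ∀ x, T.Pi₁ k (T.Λ₁ x) = conj (T.Λ₂ x (T.Pi₂ k)) := by
    intro x
    have h := T.green k x
    rw [hB, hk, inner_zero_right, neg_zero, sub_zero, eq_comm, sub_eq_zero] at h
    exact h
  constructor
  · ext g
    obtain ⟨x, hx⟩ := T.surjective_Λ (g, 0)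
    simp only [Prod.mk.injEq] at hx
    have h := h1 x
    rw [hx.1, hx.2] at h
    simpa using h
  · obtain ⟨x, hx⟩ := T.surjective_Λ (0, rieszIso G₂ (T.Pi₂ k))
    simp only [Prod.mk.injEq] at hx
    have h := h1 x
    rw [hx.1, hx.2, map_zero, rieszIso_apply, inner_conj_symm, eq_comm,
      inner_self_eq_zero] at h
    exact h

/-- Surjectivity of Λ supplies z₂, but surjectivity of Π supplies only some y in dom B. Removing its
part orthogonal to ran A keeps its boundary values and makes it of the form Az₁. -/
theorem exists_Γ_eq (T : D.BoundaryTriplet G₁ G₂) (g : WithLp 2 (G₁ × G₂))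
    (f : AntiDual (WithLp 2 (G₁ × G₂))) : ∃ z, T.Γ₀ z = g ∧ T.Γ₁ z = f := by
  obtain ⟨f₁, f₂, rfl⟩ := exists_antiDualProd_eq f
  obtain ⟨x, hx⟩ := T.surjective_Λ (g.fst, f₂)
  obtain ⟨y, hy⟩ := T.surjective_Pi (-f₁, g.snd)
  simp only [Prod.mk.injEq] at hx hy
  obtain ⟨z, k, hyz, hk⟩ := D.exists_energyA_add (y : Y)
  obtain ⟨k', hk', hBk'⟩ := (LinearPMap.mem_graph_iff _).1
    (D.mem_B_graph (y := k) (y' := 0) fun x => by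
      rw [inner_zero_left]; exact (hk (D.toDom.symm x)).symm)
  simp only [neg_zero] at hk' hBk'
  have hPi := T.Pi_eq_zero hBk' fun x => by
    rw [hk', ← inner_conj_symm]
    exact (congrArg conj (hk (D.toDom.symm x))).trans (map_zero _)
  have hzy : D.energyA z = (y - k' : D.B.domain) := by
    rw [Submodule.coe_sub, hk', hyz, add_sub_cancel_right]
  let p : D.maxDomain := ⟨WithLp.toLp 2 (z, (x : X)), by
    refine ⟨?_, x.2⟩
    change D.energyA z ∈ D.B.domain
    rw [hzy]; exact Subtype.mem _⟩
  have hv : D.velocity p = x := rfl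
  have hs : D.strain p = y - k' := Subtype.ext hzy
  refine ⟨p, ?_, ?_⟩
  · change WithLp.toLp 2 (T.Λ₁ (D.velocity p), T.Pi₂ (D.strain p)) = g
    rw [hv, hs, map_sub, hPi.2, sub_zero, hx.1, hy.2]
    rfl
  · change antiDualProd (-(T.Pi₁ (D.strain p)), T.Λ₂ (D.velocity p)) = _
    rw [hv, hs, map_sub, hPi.1, sub_zero, hx.2, hy.1, neg_neg]

variable [CompleteSpace G₁]

/-- The incoming wave `(1/√2) (R Γ₀ + Γ₁)`. -/
def incoming (T : D.BoundaryTriplet G₁ G₂) :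
    D.maxOperator.domain →ₗ[ℂ] AntiDual (WithLp 2 (G₁ × G₂)) :=
  (1 / ((√2 : ℝ) : ℂ)) • (T.rieszΓ₀ + T.Γ₁)

/-- The outgoing wave `(1/√2) (R Γ₀ - Γ₁)`. -/
def outgoing (T : D.BoundaryTriplet G₁ G₂) :
    D.maxOperator.domain →ₗ[ℂ] AntiDual (WithLp 2 (G₁ × G₂)) :=
  (1 / ((√2 : ℝ) : ℂ)) • (T.rieszΓ₀ - T.Γ₁)

theorem incoming_apply (T : D.BoundaryTriplet G₁ G₂) (z : D.maxDomain) :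
    T.incoming z = (1 / ((√2 : ℝ) : ℂ)) • (rieszIso _ (T.Γ₀ z) + T.Γ₁ z) := rfl

theorem outgoing_apply (T : D.BoundaryTriplet G₁ G₂) (z : D.maxDomain) :
    T.outgoing z = (1 / ((√2 : ℝ) : ℂ)) • (rieszIso _ (T.Γ₀ z) - T.Γ₁ z) := rfl

theorem isScatteringTriple (T : D.BoundaryTriplet G₁ G₂) :
    IsScatteringTriple D.maxOperator T.incoming T.outgoing := by
  have hc : (1 / ((√2 : ℝ) : ℂ)) * (1 / ((√2 : ℝ) : ℂ)) = 1 / 2 := by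
    rw [div_mul_div_comm, one_mul, ← Complex.ofReal_mul, Real.mul_self_sqrt zero_le_two]
    norm_num
  have hconj : conj (1 / ((√2 : ℝ) : ℂ)) = 1 / ((√2 : ℝ) : ℂ) := by
    rw [map_div₀, map_one, Complex.conj_ofReal]
  refine .of_isClosed D.maxOperator_isClosed (fun z w => ?_) (fun a b => ?_)
    fun w w' => D.mem_maxOperator_graph_of_adjoint
  · refine (T.inner_maxOperator z w).trans ?_
    rw [← inner_rieszIso_left, ← inner_rieszIso_right]
    exact (inner_smul_add_sub_inner_smul_sub hc hconj _ _ _ _).symm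
  · obtain ⟨z, hz, hz'⟩ := T.exists_Γ_eq
      ((rieszIso _).symm ((1 / ((√2 : ℝ) : ℂ)) • (a + b))) ((1 / ((√2 : ℝ) : ℂ)) • (a - b))
    refine ⟨z, ?_, ?_⟩
    · rw [T.incoming_apply z, hz, hz', LinearIsometryEquiv.apply_symm_apply]
      exact smul_smul_add_add_smul_sub hc a b
    · rw [T.outgoing_apply z, hz, hz', LinearIsometryEquiv.apply_symm_apply]
      exact smul_smul_add_sub_smul_sub hc a b

theorem colligation_eq_node (T : D.BoundaryTriplet G₁ G₂)
    (P : AntiDual (WithLp 2 (G₁ × G₂)) →L[ℂ] AntiDual (WithLp 2 (G₁ × G₂))) :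
    T.colligation P = IsScatteringTriple.node T.incoming T.outgoing P := by
  have hK : (T.colligation P).K = (IsScatteringTriple.node T.incoming T.outgoing P).K := by
    ext1 z
    change (-1 / ((√2 : ℝ) : ℂ)) • P (T.rieszΓ₀ z - T.Γ₁ z) =
      -P ((1 / ((√2 : ℝ) : ℂ)) • (T.rieszΓ₀ z - T.Γ₁ z))
    rw [map_smul, neg_div]
    exact neg_smul (1 / ((√2 : ℝ) : ℂ)) (P (T.rieszΓ₀ z - T.Γ₁ z))
  change Colligation.mk _ _ _ (T.colligation P).K = _
  rw [hK]
  rfl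

end BoundaryTriplet

end SecondOrderSystem

/-- Unitary operators are the surjective isometries. -/
theorem mem_unitary_iff_norm_map_and_surjective {H : Type*} [NormedAddCommGroup H]
    [InnerProductSpace ℂ H] [CompleteSpace H] (P : H →L[ℂ] H) :
    P ∈ unitary (H →L[ℂ] H) ↔ (∀ g, ‖P g‖ = ‖g‖) ∧ Function.Surjective P := by
  have h1 : star P * P = 1 ↔ ∀ g, ‖P g‖ = ‖g‖ := P.norm_map_iff_adjoint_comp_self.symm
  rw [Unitary.mem_iff, h1]
  refine and_congr_right fun h => ⟨fun hP g => ⟨star P g, ?_⟩, fun hP => ?_⟩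
  · exact congrArg (fun V : H →L[ℂ] H => V g) hP
  · ext g
    obtain ⟨x, rfl⟩ := hP g
    exact congrArg P (congrArg (fun V : H →L[ℂ] H => V x) (h1.2 h))

end

theorem theorem3p5 {X Y G₁ G₂ : Type*}
    [NormedAddCommGroup X] [InnerProductSpace ℂ X] [CompleteSpace X]
    [NormedAddCommGroup Y] [InnerProductSpace ℂ Y] [CompleteSpace Y]
    [NormedAddCommGroup G₁] [InnerProductSpace ℂ G₁] [CompleteSpace G₁]
    [NormedAddCommGroup G₂] [InnerProductSpace ℂ G₂] [CompleteSpace G₂]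
    (D : SecondOrderSystem X Y) (T : D.BoundaryTriplet G₁ G₂)
    (P : AntiDual (WithLp 2 (G₁ × G₂)) →L[ℂ] AntiDual (WithLp 2 (G₁ × G₂))) :
    D.minOperator.adjoint = D.maxOperator ∧
    ((T.colligation P).IsScatteringPassive ↔ ‖P‖ ≤ 1) ∧
    ((T.colligation P).IsScatteringEnergyPreserving ↔ ∀ g, ‖P g‖ = ‖g‖) ∧
    (P ∈ unitary (AntiDual (WithLp 2 (G₁ × G₂)) →L[ℂ] AntiDual (WithLp 2 (G₁ × G₂))) ↔
      (T.colligation P).IsScatteringEnergyPreserving ∧ Function.Surjective P) ∧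
    (FiniteDimensional ℂ (WithLp 2 (G₁ × G₂)) →
      ((T.colligation P).IsScatteringEnergyPreserving ↔
        P ∈ unitary (AntiDual (WithLp 2 (G₁ × G₂)) →L[ℂ] AntiDual (WithLp 2 (G₁ × G₂))))) := by
  have h := T.isScatteringTriple
  rw [T.colligation_eq_node, h.node_isScatteringPassive_iff,
    h.node_isScatteringEnergyPreserving_iff, mem_unitary_iff_norm_map_and_surjective]
  refine ⟨h.adjoint_adjoint, Iff.rfl, Iff.rfl, Iff.rfl, fun _ => ⟨fun hP => ⟨hP, ?_⟩, And.left⟩⟩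
  -- A norm-preserving map is injective, hence surjective in finite dimension; the Riesz isomorphism
  -- carries finite dimension from G to its anti-dual.
  have : FiniteDimensional ℂ (AntiDual (WithLp 2 (G₁ × G₂))) :=
    (rieszIso (WithLp 2 (G₁ × G₂))).toLinearEquiv.finiteDimensional
  refine LinearMap.surjective_of_injective (f := P.toLinearMap) ?_
  rw [injective_iff_map_eq_zero]
  intro g hg
  rw [← norm_eq_zero, ← hP g]
  exact norm_eq_zero.2 hg
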